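/- Let $J\ge 1$ and $1\le K\le N$ be integers, and put $m(J,N,K)=KJ+K\log\frac NK$. The block sparsity model $\mathcal S_K$ is the set of matrices $\beta\in\mathbb R^{J\times N}$ (identified with vectors of length $d=JN$) that vanish outside some $K$ columns. For reals $u,v$ let $\mathcal F(u,v)\subseteq\mathcal S_K$ be the set of all $\beta$ for which there is a set $L$ of $K$ columns such that every entry of $\beta$ in a column of $L$ is $u$ or $v$ and every other entry is $0$. For a random design $X\in\mathbb R^{n\times d}$ with i.i.d. entries, a noise vector $e\in\mathbb R^n$, and a measurable $f:\mathbb R^n\to\mathbb R^n$, the data are $z=f(X\bar\beta+e)$. Here $\bar\beta$, $X$, $e$ are independent, a procedure is any (possibly randomized) measurable rule that produces an estimate $\hat\beta\in\mathbb R^{J\times N}$ from the data it is given, and $\|\cdot\|$ is the Euclidean norm. In every statement below the constants $c,\varepsilon,C_1,C_2$ do not depend on $J,N,K,n$ or $\sigma$. 1. (Cardinality.) If $u\neq v$ are both non-zero, then $\mathcal F=\mathcal F(u,v)$ is finite and $$|\mathcal F|=2^{KJ}\binom NK\ \ge\ 2^{KJ}\Big(\frac NK\Big)^K .$$ 2.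 (Necessary number of samples, noisy case.) There are constants $c>0$ and $\varepsilon\in(0,1)$ such that, for all $J,N,K$ as above, all $\sigma>0$, $C_0>0$ and all $n\le c\,m(J,N,K)$, the following holds with $u=\frac{C_0\sigma\sqrt d}{\sqrt{2(1-\varepsilon)}}$ and $v=u+\frac{C_0\sigma\sqrt d}{\sqrt{1-\varepsilon}}$. If $\bar\beta$ is uniform on $\mathcal F(u,v)$, the entries of $X$ are $N(0,1)$ and the entries of $e$ are i.i.d. normal with mean $0$ and standard deviation $\sigma$, then for every $f$, every procedure that infers $\hat\beta$ from $z$, and every $0<C\le C_0$, $$\mathbb P\big(\|\bar\beta-\hat\beta\|\ge C\|e\|\big)\ge\tfrac1{10}.$$ 3. (Necessary number of samples, noiseless case.) There is a constant $c>0$ such that, for all $J,N,K$ as above and all $n\le c\,m(J,N,K)$, if $\bar\beta$ is uniform on $\mathcal F(1,-1)$, $e=0$, and the entries of $X$ are normal with mean $\frac1{s\sqrt2}$ and variance $\frac1s$, where $s=KJ$, then for every $f$ and every procedure that infers $\hat\beta$ from $z$, $\mathbb P(\hat\beta\ne\bar\beta)\ge\frac12$. 4. (Necessary number of samples when the design is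 observed.) For every $C_0>0$ there is $c>0$ such that, for all $J,N,K$ as above and all $\sigma>0$, there are non-zero reals $u\ne v$ with the following property. For every $n\le c\,m(J,N,K)$, if $\bar\beta$ is uniform on $\mathcal F(u,v)$, the entries of $X$ are normal with mean $0$ and variance $\frac1n$, and the entries of $e$ are i.i.d. normal with mean $0$ and standard deviation $\sigma$, then for every $f$, every procedure that infers $\hat\beta$ from the pair $(X,z)$, and every $0<C\le C_0$, $\mathbb P(\|\bar\beta-\hat\beta\|\ge C\|e\|)\ge\frac1{10}$. 5. (Matching upper bound.) There are constants $C_1,C_2>0$ such that, for all $J,N,K$ as above and all $n\ge C_1\,m(J,N,K)$, there is a measurable map $\Delta$, which takes a pair in $\mathbb R^{n\times d}\times\mathbb R^n$ to a matrix in $\mathbb R^{J\times N}$, with the following property. If the entries of $X$ are normal with mean $0$ and variance $\frac1n$, then, outside an event of probability at most $e^{-n/C_1}$, $$\|\beta-\Delta(X,X\beta+e)\|\le C_2\|e\|\qquad\text{for all }\beta\in\mathcal S_K\text{ and all }e\in\mathbb R^n .$$ Thus the necessary number of samples is $\Omega(KJ+K\log\frac NK)$, and it matches the upper bound $O(KJ+K\log\frac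 NK)$. -/

import Mathlib

open MeasureTheory ProbabilityTheory
open scoped NNReal ENNReal

noncomputable section

/-- Signals `β ∈ ℝ^{J × N}`: matrices with `J` rows and `N` columns (blocks). -/
abbrev Signal (J N : ℕ) : Type := Fin J × Fin N → ℝ

/-- Design matrices `X ∈ ℝ^{n × d}`, `d = J N`; row `i` produces the `i`-th observation. -/
abbrev Design (n J N : ℕ) : Type := Fin n → Fin J × Fin N → ℝ

/-- The Euclidean norm (plain function types carry the sup norm). -/
def l2norm {ι : Type*} [Fintype ι] (x : ι → ℝ) : ℝ := Real.sqrt (∑ i, x i ^ 2)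

/-- The matrix-vector product `X β`. -/
def designMul {n J N : ℕ} (X : Design n J N) (β : Signal J N) : Fin n → ℝ :=
  fun i => ∑ p, X i p * β p

/-- The block sparsity model `S_K`: all signals that vanish outside some `K` columns. -/
def blockSparse (J N K : ℕ) : Set (Signal J N) :=
  {β | ∃ L : Finset (Fin N), L.card = K ∧ ∀ i, ∀ j ∉ L, β (i, j) = 0}

/-- The restricted ensemble `F` on the block sparsity model: signals that vanish outside `K` columns
and all of whose entries in these columns take one of the two values `u`, `v`. -/
def blockEnsemble (J N K : ℕ) (u v : ℝ) : Set (Signal J N) :=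
  {β | ∃ L : Finset (Fin N), L.card = K ∧ (∀ i, ∀ j ∉ L, β (i, j) = 0) ∧
    ∀ i, ∀ j ∈ L, β (i, j) = u ∨ β (i, j) = v}

/-- Law of a design matrix with independent entries of law `N(m, τ)`, `τ` being the variance. -/
def gaussianDesign (n J N : ℕ) (m : ℝ) (τ : ℝ≥0) : Measure (Design n J N) :=
  Measure.pi fun _ => Measure.pi fun _ => gaussianReal m τ

/-- Law of a noise vector with independent entries of mean `0` and standard deviation `σ`. -/
def gaussianNoise (n : ℕ) (σ : ℝ≥0) : Measure (Fin n → ℝ) :=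
  Measure.pi fun _ => gaussianReal 0 (σ ^ 2)

/-- The order `K J + K log (N / K)` of the number of samples. -/
def blockSampleOrder (J N K : ℕ) : ℝ := K * J + K * Real.log (N / K)

/-- Noiseless prediction: `β` is uniform on `F`, `X` has law `μX`, the data are `z = f (X β)`, and a
possibly randomized procedure `κ` (Markov chain `β → z → b`) infers `b` from `z`. The value is the
probability that `b ≠ β`. -/
def noiselessError {n J N : ℕ} (F : Set (Signal J N)) (μX : Measure (Design n J N))
    (f : (Fin n → ℝ) → (Fin n → ℝ)) (κ : Kernel (Fin n → ℝ) (Signal J N)) : ℝ≥0∞ :=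
  ∫⁻ β, ∫⁻ X, κ (f (designMul X β)) {b | b ≠ β} ∂μX ∂(uniformOn F)

/-- Noisy prediction: `β` is uniform on `F`, `X` has law `μX`, `e` has law `μe`, all independent, the
data are `z = f (X β + e)`, and a possibly randomized procedure `κ` (Markov chain `β → z → b`) infers
`b` from `z`. The value is the probability that `‖β - b‖ ≥ C ‖e‖`. -/
def noisyError {n J N : ℕ} (F : Set (Signal J N)) (μX : Measure (Design n J N))
    (μe : Measure (Fin n → ℝ)) (f : (Fin n → ℝ) → (Fin n → ℝ))
    (κ : Kernel (Fin n → ℝ) (Signal J N)) (C : ℝ) : ℝ≥0∞ :=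
  ∫⁻ β, ∫⁻ X, ∫⁻ e, κ (f (designMul X β + e)) {b | C * l2norm e ≤ l2norm (β - b)}
    ∂μe ∂μX ∂(uniformOn F)

/-- The same probability of `‖β - b‖ ≥ C ‖e‖` for procedures that infer `b` from the data `z` and the
design matrix `X`. -/
def noisyErrorKnownDesign {n J N : ℕ} (F : Set (Signal J N)) (μX : Measure (Design n J N))
    (μe : Measure (Fin n → ℝ)) (f : (Fin n → ℝ) → (Fin n → ℝ))
    (κ : Kernel (Design n J N × (Fin n → ℝ)) (Signal J N)) (C : ℝ) : ℝ≥0∞ :=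
  ∫⁻ β, ∫⁻ X, ∫⁻ e, κ (X, f (designMul X β + e)) {b | C * l2norm e ≤ l2norm (β - b)}
    ∂μe ∂μX ∂(uniformOn F)

end

open MeasureTheory ProbabilityTheory
open scoped NNReal ENNReal

noncomputable section

/-! The lower bounds are counting arguments resting on `sum_lintegral_kernel_le`. Suppose the laws
of the data, one for each signal, are dominated by a common measure `Q` up to remainders of mass at
most `r`, and every estimate is acceptable for at most `ℓ` signals. Then the average probability of
success is at most `ℓ * Q univ / |F| + r`. In the noisy cases the acceptance radius `C ‖e‖` is
random; `one_le_lintegral_error_add` replaces it by a fixed radius and pays the probability that the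
noise is large.

If the design is not observed, the entries of `X β` are i.i.d. Gaussian, and their mean and variance
see `β` only through the number of its entries equal to `v`. Hence at most `K J + 1` laws occur.
Their sum serves as `Q`, while the ensemble has at least `2 (K J + 1)` members once the sample order
exceeds 2 (`two_mul_count_le_card`), so the guess is wrong half of the time.

If the design is observed, `z` given `X` is Gaussian with mean `X β`. On a ball carrying most of its
mass, its density relative to one centred Gaussian of larger variance is at most `exp (m / 140)`,
whatever the mean (`map_knownDesign_restrict_le`). On the other hand, only a fraction `exp (-m /
70)` of the ensemble with values `±u` lies near any given vector
(`card_filter_close_blockEnsembleFinset_le`). The product of the two is small.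

For the upper bound, Chernoff bounds and a union bound over the lattice points of a ball, for all
supports of at most `2 K` columns, show that a Gaussian design is bounded below on `2
K`-block-sparse signals (`gaussianDesign_not_bounded_below_le`). Least squares on the support with
the smallest residual then recovers stably (`exists_measurable_decoder`). -/

/-! ### Product measures and Gaussian vectors. -/

theorem lintegral_pi_prod {ι : Type*} [Fintype ι] {α : ι → Type*} [∀ i, MeasurableSpace (α i)]
    (μ : ∀ i, Measure (α i)) [∀ i, IsProbabilityMeasure (μ i)] {f : ∀ i, α i → ℝ≥0∞}
    (hf : ∀ i, Measurable (f i)) :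
    ∫⁻ x, ∏ i, f i (x i) ∂(Measure.pi μ) = ∏ i, ∫⁻ y, f i y ∂(μ i) := by
  have h := lintegral_prod_eq_prod_lintegral_of_indepFun (μ := Measure.pi μ) Finset.univ
    (fun i (x : ∀ i, α i) => f i (x i))
    (iIndepFun_pi (X := f) fun i => (hf i).aemeasurable)
    (fun i => (hf i).comp (measurable_pi_apply i))
  rw [h]
  refine Finset.prod_congr rfl fun i _ => ?_
  rw [← (measurePreserving_eval μ i).lintegral_comp (hf i)]

theorem pi_withDensity {ι : Type*} [Fintype ι] {α : ι → Type*} [∀ i, MeasurableSpace (α i)]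
    (μ : ∀ i, Measure (α i)) [∀ i, IsProbabilityMeasure (μ i)] {f : ∀ i, α i → ℝ≥0∞}
    (hf : ∀ i, Measurable (f i)) [∀ i, SigmaFinite ((μ i).withDensity (f i))] :
    Measure.pi (fun i => (μ i).withDensity (f i)) =
      (Measure.pi μ).withDensity fun x => ∏ i, f i (x i) := by
  refine Measure.pi_eq fun s hs => ?_
  rw [withDensity_apply _ (MeasurableSet.univ_pi hs), ← lintegral_indicator (MeasurableSet.univ_pi hs)]
  have h : (Set.univ.pi s).indicator (fun x => ∏ i, f i (x i))
      = fun x : (∀ i, α i) => ∏ i, (s i).indicator (f i) (x i) := by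
    ext x
    by_cases hx : x ∈ Set.univ.pi s
    · rw [Set.indicator_of_mem hx]
      exact Finset.prod_congr rfl fun i _ => (Set.indicator_of_mem (hx i trivial) _).symm
    · rw [Set.indicator_of_notMem hx]
      simp only [Set.mem_pi, Set.mem_univ, true_implies, not_forall] at hx
      obtain ⟨i, hi⟩ := hx
      exact (Finset.prod_eq_zero (Finset.mem_univ i) (Set.indicator_of_notMem hi _)).symm
  rw [h, lintegral_pi_prod μ fun i => (hf i).indicator (hs i)]
  refine Finset.prod_congr rfl fun i _ => ?_
  rw [lintegral_indicator (hs i), withDensity_apply _ (hs i)]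

theorem map_sum_mul_pi_gaussianReal {ι : Type*} [Fintype ι] (m : ℝ) (τ : ℝ≥0) (β : ι → ℝ) :
    (Measure.pi fun _ : ι => gaussianReal m τ).map (fun x => ∑ p, x p * β p) =
      gaussianReal (m * ∑ p, β p) (τ * Real.toNNReal (∑ p, β p ^ 2)) := by
  classical
  have hmeas : ∀ i, Measurable fun x : ι → ℝ => x i * β i := fun i => by fun_prop
  have hind : iIndepFun (fun i (x : ι → ℝ) => x i * β i)
      (Measure.pi fun _ : ι => gaussianReal m τ) :=
    iIndepFun_pi (X := fun i (y : ℝ) => y * β i) fun i => by fun_prop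
  have hone : ∀ i, (Measure.pi fun _ : ι => gaussianReal m τ).map (fun x => x i * β i)
      = gaussianReal (m * β i) (τ * Real.toNNReal (β i ^ 2)) := fun i => by
    have h1 : (fun x : ι → ℝ => x i * β i) = (fun y => y * β i) ∘ Function.eval i := rfl
    rw [h1, ← Measure.map_map (g := fun y : ℝ => y * β i) (by fun_prop)
      (measurable_pi_apply i : Measurable (Function.eval i)),
      (measurePreserving_eval (fun _ : ι => gaussianReal m τ) i).map_eq,
      gaussianReal_map_mul_const, mul_comm m]
    congr 1
    rw [mul_comm]
    congr 1
    ext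
    simp [sq_nonneg]
  have key : ∀ s : Finset ι, (Measure.pi fun _ : ι => gaussianReal m τ).map
      (fun x => ∑ p ∈ s, x p * β p) =
      gaussianReal (m * ∑ p ∈ s, β p) (τ * Real.toNNReal (∑ p ∈ s, β p ^ 2)) := by
    intro s
    induction s using Finset.induction_on with
    | empty =>
      simp only [Finset.sum_empty, mul_zero, Real.toNNReal_zero]
      rw [Measure.map_const, gaussianReal_zero_var]
      simp
    | insert i s hi ih =>
      have h := hind.indepFun_finsetSum_of_notMem hmeas hi
      have h2 : (fun x : ι → ℝ => ∑ p ∈ insert i s, x p * β p)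
          = (∑ p ∈ s, fun x : ι → ℝ => x p * β p) + fun x => x i * β i := by
        ext x
        rw [Finset.sum_insert hi, Pi.add_apply, Finset.sum_apply, add_comm]
      rw [h2, gaussianReal_add_gaussianReal_of_indepFun h (m₁ := m * ∑ p ∈ s, β p)
        (v₁ := τ * Real.toNNReal (∑ p ∈ s, β p ^ 2)) (by
          rw [← ih]; congr 1; ext x; rw [Finset.sum_apply]) (hone i),
        Finset.sum_insert hi, Finset.sum_insert hi,
        Real.toNNReal_add (sq_nonneg _) (Finset.sum_nonneg fun _ _ => sq_nonneg _)]
      congr 1 <;> ring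
  exact key Finset.univ

theorem measurable_designMul {n J N : ℕ} (β : Signal J N) :
    Measurable fun X : Design n J N => designMul X β := by
  unfold designMul; fun_prop

instance isProbabilityMeasure_gaussianDesign (n J N : ℕ) (m : ℝ) (τ : ℝ≥0) :
    IsProbabilityMeasure (gaussianDesign n J N m τ) := by
  unfold gaussianDesign; infer_instance

instance isProbabilityMeasure_gaussianNoise (n : ℕ) (σ : ℝ≥0) :
    IsProbabilityMeasure (gaussianNoise n σ) := by
  unfold gaussianNoise; infer_instance

/-- The rows of the design are independent, so this reduces to a linear form in one Gaussian row.
The law depends on `β` only through its sum and its sum of squares, which is what makes an unseen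
design uninformative. -/
theorem map_designMul_gaussianDesign {n J N : ℕ} (m : ℝ) (τ : ℝ≥0) (β : Signal J N) :
    (gaussianDesign n J N m τ).map (fun X => designMul X β) =
      Measure.pi fun _ => gaussianReal (m * ∑ p, β p) (τ * Real.toNNReal (∑ p, β p ^ 2)) := by
  unfold gaussianDesign
  have h := Measure.pi_map_pi (ι := Fin n)
    (μ := fun _ => Measure.pi fun _ : Fin J × Fin N => gaussianReal m τ)
    (f := fun _ (x : Fin J × Fin N → ℝ) => ∑ p, x p * β p)
    (hμ := fun _ => by rw [map_sum_mul_pi_gaussianReal]; infer_instance)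
    (fun _ => Measurable.aemeasurable (by fun_prop))
  simp only [map_sum_mul_pi_gaussianReal] at h
  exact h

theorem lintegral_exp_mul_sq_gaussianReal {v : ℝ≥0} (hv : v ≠ 0) {t : ℝ} (ht : 2 * t * v < 1) :
    ∫⁻ x, ENNReal.ofReal (Real.exp (t * x ^ 2)) ∂(gaussianReal 0 v) =
      ENNReal.ofReal (Real.sqrt (1 / (1 - 2 * t * v))) := by
  have hv' : (0 : ℝ) < v := by positivity
  have hb : 0 < 1 / (2 * v) - t := by
    rw [sub_pos, lt_div_iff₀ (by positivity)]; linarith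
  rw [gaussianReal_of_var_ne_zero _ hv,
    lintegral_withDensity_eq_lintegral_mul _ (measurable_gaussianPDF _ _) (by fun_prop)]
  have h : ∀ x : ℝ, (gaussianPDF 0 v * fun x => ENNReal.ofReal (Real.exp (t * x ^ 2))) x
      = ENNReal.ofReal ((Real.sqrt (2 * Real.pi * v))⁻¹ *
          Real.exp (-(1 / (2 * v) - t) * x ^ 2)) := fun x => by
    rw [Pi.mul_apply, gaussianPDF, ← ENNReal.ofReal_mul (gaussianPDFReal_nonneg _ _ _),
      gaussianPDFReal, mul_assoc, ← Real.exp_add]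
    congr 3
    field_simp
    ring
  simp only [h]
  rw [← ofReal_integral_eq_lintegral_ofReal ((integrable_exp_neg_mul_sq hb).const_mul _)
    (Filter.Eventually.of_forall fun x => by positivity), integral_const_mul, integral_gaussian,
    ← Real.sqrt_inv, ← Real.sqrt_mul (by positivity)]
  congr 2
  have h1 : 1 - 2 * t * v ≠ 0 := by linarith
  have h2 : 1 / (2 * (v : ℝ)) - t = (1 - 2 * t * v) / (2 * v) := by field_simp
  rw [h2]
  field_simp

theorem lintegral_sum_sq_pi_gaussianReal (n : ℕ) (w : ℝ≥0) :
    ∫⁻ x, ENNReal.ofReal (∑ i, x i ^ 2) ∂(Measure.pi fun _ : Fin n => gaussianReal 0 w) =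
      n * w := by
  have h1 : ∫⁻ y, ENNReal.ofReal (y ^ 2) ∂(gaussianReal 0 w) = w := by
    have hi : Integrable (fun y : ℝ => y ^ 2) (gaussianReal 0 w) :=
      (memLp_id_gaussianReal' 2 (by simp)).integrable_sq
    rw [← ofReal_integral_eq_lintegral_ofReal hi (Filter.Eventually.of_forall fun y => sq_nonneg y)]
    have h := variance_fun_id_gaussianReal (μ := 0) (v := w)
    rw [variance_of_integral_eq_zero (by fun_prop) (by simp)] at h
    rw [h]; simp
  simp only [ENNReal.ofReal_sum_of_nonneg fun i _ => sq_nonneg _]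
  rw [lintegral_finsetSum _ fun i _ => by fun_prop]
  have h2 : ∀ i : Fin n, ∫⁻ x, ENNReal.ofReal (x i ^ 2)
      ∂(Measure.pi fun _ : Fin n => gaussianReal 0 w) = w := fun i => by
    rw [← h1, ← (measurePreserving_eval (fun _ : Fin n => gaussianReal 0 w) i).lintegral_comp
      (f := fun y => ENNReal.ofReal (y ^ 2)) (by fun_prop)]
  simp [h2]

/-- Markov's inequality for the squared norm of a Gaussian vector. -/
theorem pi_gaussianReal_sum_sq_ge_le (n : ℕ) (w : ℝ≥0) {a : ℝ} (ha : 0 < a) :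
    (Measure.pi fun _ : Fin n => gaussianReal 0 w) {x | a ≤ ∑ i, x i ^ 2} ≤
      ENNReal.ofReal (n * w / a) := by
  have h := meas_ge_le_lintegral_div (μ := Measure.pi fun _ : Fin n => gaussianReal 0 w)
    (f := fun x => ENNReal.ofReal (∑ i, x i ^ 2)) (Measurable.aemeasurable (by fun_prop)) (ε := ENNReal.ofReal a)
    (by simpa using ha) (by simp)
  rw [lintegral_sum_sq_pi_gaussianReal] at h
  refine (measure_mono fun x hx => ?_).trans (h.trans_eq ?_)
  · exact ENNReal.ofReal_le_ofReal hx
  · rw [ENNReal.ofReal_div_of_pos ha, ENNReal.ofReal_mul (by positivity)]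
    simp

/-! ### Cardinality of the ensemble and size of the sample order. -/

/-- The signals supported on the columns in `L` with all entries there equal to `u` or `v`. -/
def columnPatterns (J : ℕ) {N : ℕ} (L : Finset (Fin N)) (u v : ℝ) : Finset (Signal J N) :=
  Fintype.piFinset fun p : Fin J × Fin N => if p.2 ∈ L then {u, v} else {0}

/-- The ensemble `blockEnsemble` as a finset. -/
def blockEnsembleFinset (J N K : ℕ) (u v : ℝ) : Finset (Signal J N) :=
  (Finset.powersetCard K Finset.univ).biUnion fun L => columnPatterns J L u v

theorem mem_columnPatterns {J N : ℕ} {L : Finset (Fin N)} {u v : ℝ} {β : Signal J N} :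
    β ∈ columnPatterns J L u v ↔
      (∀ i, ∀ j ∉ L, β (i, j) = 0) ∧ ∀ i, ∀ j ∈ L, β (i, j) = u ∨ β (i, j) = v := by
  simp only [columnPatterns, Fintype.mem_piFinset, Prod.forall]
  constructor
  · intro h
    refine ⟨fun i j hj => ?_, fun i j hj => ?_⟩
    · simpa [hj] using h i j
    · simpa [hj] using h i j
  · rintro ⟨h1, h2⟩ i j
    by_cases hj : j ∈ L
    · simpa [hj] using h2 i j hj
    · simpa [hj] using h1 i j hj

theorem mem_blockEnsembleFinset {J N K : ℕ} {u v : ℝ} {β : Signal J N} :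
    β ∈ blockEnsembleFinset J N K u v ↔ ∃ L : Finset (Fin N), L.card = K ∧
      β ∈ columnPatterns J L u v := by
  simp [blockEnsembleFinset]

theorem coe_blockEnsembleFinset (J N K : ℕ) (u v : ℝ) :
    (blockEnsembleFinset J N K u v : Set (Signal J N)) = blockEnsemble J N K u v := by
  ext β
  rw [Finset.mem_coe, mem_blockEnsembleFinset]
  simp only [mem_columnPatterns]
  rfl

theorem card_filter_snd_mem (J : ℕ) {N : ℕ} (L : Finset (Fin N)) :
    (Finset.univ.filter fun p : Fin J × Fin N => p.2 ∈ L).card = L.card * J := by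
  have h : (Finset.univ.filter fun p : Fin J × Fin N => p.2 ∈ L)
      = (Finset.univ : Finset (Fin J)) ×ˢ L := by ext; simp
  rw [h, Finset.card_product, Finset.card_univ, Fintype.card_fin, mul_comm]

theorem card_columnPatterns (J : ℕ) {N : ℕ} (L : Finset (Fin N)) {u v : ℝ} (huv : u ≠ v) :
    (columnPatterns J L u v).card = 2 ^ (L.card * J) := by
  rw [columnPatterns, Fintype.card_piFinset, ← card_filter_snd_mem J L, ← Finset.prod_const,
    Finset.prod_filter]
  refine Finset.prod_congr rfl fun p _ => ?_
  split_ifs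
  · exact Finset.card_pair huv
  · simp

theorem mem_iff_of_mem_columnPatterns {J N : ℕ} {L : Finset (Fin N)} {u v : ℝ} (hu : u ≠ 0)
    (hv : v ≠ 0) {β : Signal J N} (hβ : β ∈ columnPatterns J L u v) (p : Fin J × Fin N) :
    p.2 ∈ L ↔ β p ≠ 0 := by
  rw [mem_columnPatterns] at hβ
  constructor
  · intro h
    rcases hβ.2 p.1 p.2 h with h' | h' <;> rw [show β p = _ from h'] <;> assumption
  · intro h
    by_contra h'
    exact h (hβ.1 p.1 p.2 h')

/-- As both values are non-zero, a signal determines its column set; it can be read off in row `0`,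
which exists because `1 ≤ J`. -/
theorem pairwiseDisjoint_columnPatterns {J N : ℕ} (hJ : 1 ≤ J) {u v : ℝ} (hu : u ≠ 0)
    (hv : v ≠ 0) (S : Set (Finset (Fin N))) :
    S.PairwiseDisjoint fun L => columnPatterns J L u v := by
  intro L _ L' _ hne
  refine Finset.disjoint_left.2 fun β h h' => hne ?_
  ext j
  rw [mem_iff_of_mem_columnPatterns hu hv h (⟨0, hJ⟩, j),
    mem_iff_of_mem_columnPatterns hu hv h' (⟨0, hJ⟩, j)]

theorem card_blockEnsembleFinset {J : ℕ} (N K : ℕ) {u v : ℝ} (hJ : 1 ≤ J) (hu : u ≠ 0)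
    (hv : v ≠ 0) (huv : u ≠ v) :
    (blockEnsembleFinset J N K u v).card = 2 ^ (K * J) * N.choose K := by
  rw [blockEnsembleFinset, Finset.card_biUnion (pairwiseDisjoint_columnPatterns hJ hu hv _),
    Finset.sum_congr rfl (g := fun _ => 2 ^ (K * J)), Finset.sum_const, Finset.card_powersetCard,
    Finset.card_univ, Fintype.card_fin, smul_eq_mul, mul_comm]
  intro L hL
  rw [card_columnPatterns J L huv, (Finset.mem_powersetCard.1 hL).2]

/-- Induction through `(N+1).choose (K+1) = (N+1)/(K+1) * N.choose K`, using that `(N+1)/(K+1) ≤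
N/K` for `K ≤ N`. -/
theorem div_pow_le_choose (N K : ℕ) (hKN : K ≤ N) : ((N : ℝ) / K) ^ K ≤ N.choose K := by
  induction K generalizing N with
  | zero => simp
  | succ K ih =>
    obtain ⟨N, rfl⟩ : ∃ M, N = M + 1 := ⟨N - 1, by omega⟩
    have hKN' : K ≤ N := by omega
    have hc : ((N + 1).choose (K + 1) : ℝ) = (N + 1 : ℝ) / (K + 1) * N.choose K := by
      have h := Nat.add_one_mul_choose_eq N K
      have h' : ((N : ℝ) + 1) * N.choose K = (N + 1).choose (K + 1) * (K + 1) := by exact_mod_cast h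
      field_simp
      linarith
    rw [hc, pow_succ']
    push_cast
    refine mul_le_mul_of_nonneg_left ?_ (by positivity)
    rcases Nat.eq_zero_or_pos K with rfl | hK
    · simp
    refine le_trans (pow_le_pow_left₀ (by positivity) ?_ K) (ih N hKN')
    have : (K : ℝ) ≤ N := by exact_mod_cast hKN'
    have : (0 : ℝ) < K := by exact_mod_cast hK
    rw [div_le_div_iff₀ (by positivity) (by positivity)]
    nlinarith

/-- Sums over the entries of a member of the ensemble depend only on the number of `v`s. -/
theorem exists_count_of_mem_blockEnsembleFinset {J N K : ℕ} {u v : ℝ} {β : Signal J N}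
    (hβ : β ∈ blockEnsembleFinset J N K u v) :
    ∃ j ≤ K * J, ∀ g : ℝ → ℝ, g 0 = 0 →
      ∑ p, g (β p) = ((K * J : ℕ) - j : ℝ) * g u + j * g v := by
  obtain ⟨L, hL, hβ⟩ := mem_blockEnsembleFinset.1 hβ
  rw [mem_columnPatterns] at hβ
  set A := Finset.univ.filter fun p : Fin J × Fin N => p.2 ∈ L with hA
  have hcard : A.card = K * J := by rw [hA, card_filter_snd_mem, hL]
  refine ⟨(A.filter fun p => β p = v).card, hcard ▸ Finset.card_filter_le _ _, fun g hg => ?_⟩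
  have h1 : ∑ p, g (β p) = ∑ p ∈ A, g (β p) := by
    refine (Finset.sum_subset (Finset.subset_univ _) fun p _ hp => ?_).symm
    have : β p = 0 := hβ.1 p.1 p.2 (by simpa [hA] using hp)
    rw [this, hg]
  have h2 : ∀ p ∈ A, g (β p) = if β p = v then g v else g u := by
    intro p hp
    rcases hβ.2 p.1 p.2 (by simpa [hA] using hp) with h | h
    · have h' : β p = u := h
      split_ifs with h3
      · rw [h3]
      · rw [h']
    · have h' : β p = v := h
      rw [if_pos h', h']
  have h3 : ((A.filter fun p => ¬ β p = v).card : ℝ)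
      = ((K * J : ℕ) : ℝ) - (A.filter fun p => β p = v).card := by
    rw [eq_sub_iff_add_eq, ← hcard]
    exact_mod_cast (add_comm _ _).trans (Finset.card_filter_add_card_filter_not (s := A) _)
  rw [h1, Finset.sum_congr rfl h2, Finset.sum_ite, Finset.sum_const, Finset.sum_const,
    nsmul_eq_mul, nsmul_eq_mul, h3, add_comm]

theorem le_blockSampleOrder {J N K : ℕ} (hK : 1 ≤ K) (hKN : K ≤ N) :
    ((K * J : ℕ) : ℝ) ≤ blockSampleOrder J N K := by
  have h1 : (1 : ℝ) ≤ (N : ℝ) / K := by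
    rw [le_div_iff₀ (by exact_mod_cast hK), one_mul]; exact_mod_cast hKN
  have := mul_nonneg (Nat.cast_nonneg (α := ℝ) K) (Real.log_nonneg h1)
  rw [blockSampleOrder]; push_cast; linarith

theorem one_le_blockSampleOrder {J N K : ℕ} (hJ : 1 ≤ J) (hK : 1 ≤ K) (hKN : K ≤ N) :
    1 ≤ blockSampleOrder J N K :=
  le_trans (by exact_mod_cast Nat.mul_pos hK hJ) (le_blockSampleOrder (J := J) hK hKN)

/-- With `n` at most a small multiple of the sample order, this makes the expected noise energy `n
σ²` a small fraction of `σ² d`. -/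
theorem blockSampleOrder_le {J N K : ℕ} (hJ : 1 ≤ J) (hK : 1 ≤ K) (hKN : K ≤ N) :
    blockSampleOrder J N K ≤ 2 * (J * N) := by
  have hK' : (0 : ℝ) < K := by exact_mod_cast hK
  have hKN' : (K : ℝ) ≤ N := by exact_mod_cast hKN
  have hJ' : (1 : ℝ) ≤ J := by exact_mod_cast hJ
  have hN : (0 : ℝ) < N := hK'.trans_le hKN'
  have h1 : Real.log ((N : ℝ) / K) ≤ N / K :=
    (Real.log_le_sub_one_of_pos (by positivity)).trans (by linarith)
  have h2 : (K : ℝ) * Real.log (N / K) ≤ N := by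
    calc (K : ℝ) * Real.log (N / K) ≤ K * (N / K) := mul_le_mul_of_nonneg_left h1 hK'.le
      _ = N := by field_simp
  rw [blockSampleOrder]
  nlinarith

/-- Once the sample order is large, the ensemble has twice as many members as counts of `v`s. -/
theorem two_mul_count_le_card {J N K : ℕ} (hK : 1 ≤ K) (hKN : K ≤ N)
    (hm : 2 < blockSampleOrder J N K) : 2 * (K * J + 1) ≤ 2 ^ (K * J) * N.choose K := by
  -- For `K = N` there is a single support, and the sign patterns alone must suffice: the order is
  -- then `K * J`, so it is at least 3. For `K < N` the binomial coefficient supplies the factor 2.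
  rcases hKN.eq_or_lt with rfl | hlt
  · have hs : 3 ≤ K * J := by
      have hK' : (K : ℝ) ≠ 0 := by positivity
      rw [blockSampleOrder, div_self hK', Real.log_one, mul_zero, add_zero] at hm
      exact_mod_cast hm
    rw [Nat.choose_self, mul_one]
    generalize K * J = s at hs
    induction s, hs using Nat.le_induction with
    | base => norm_num
    | succ s hs ih => rw [pow_succ]; omega
  · have h1 : 2 ≤ N.choose K := by
      obtain ⟨M, rfl⟩ : ∃ M, N = M + 1 := ⟨N - 1, by omega⟩
      obtain ⟨k, rfl⟩ : ∃ k, K = k + 1 := ⟨K - 1, by omega⟩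
      rw [Nat.choose_succ_succ']
      have h3 := Nat.choose_pos (n := M) (k := k) (by omega)
      have h4 := Nat.choose_pos (n := M) (k := k + 1) (by omega)
      omega
    have h2 : K * J + 1 ≤ 2 ^ (K * J) := Nat.lt_two_pow_self
    calc 2 * (K * J + 1) ≤ N.choose K * 2 ^ (K * J) := Nat.mul_le_mul h1 h2
      _ = _ := mul_comm _ _

/-! ### Few members of the ensemble lie near a given vector. -/

/-- The sum over all `L` factorises into `(1 + 1)` for each column of `L₀` and `(1 + y)` for every
other one. It is used with `y = K / N`, where the bound is `2 ^ K * exp K`. -/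
theorem sum_exp_neg_card_sdiff_le {N K : ℕ} (L₀ : Finset (Fin N)) {y : ℝ} (hy : 0 ≤ y) :
    ∑ L ∈ Finset.powersetCard K Finset.univ, y ^ (L \ L₀).card ≤
      2 ^ L₀.card * Real.exp (y * N) := by
  have h1 : ∀ L : Finset (Fin N), y ^ (L \ L₀).card = ∏ i ∈ L, if i ∈ L₀ then 1 else y := by
    intro L
    rw [Finset.prod_ite, Finset.prod_const_one, one_mul, Finset.prod_const, Finset.sdiff_eq_filter]
  have h2 : ∏ i : Fin N, (1 + if i ∈ L₀ then 1 else y) ≤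
      ∏ i : Fin N, ((if i ∈ L₀ then 2 else 1) * Real.exp y) := by
    refine Finset.prod_le_prod (fun i _ => by split_ifs <;> positivity) fun i _ => ?_
    have := Real.add_one_le_exp y
    split_ifs <;> linarith
  calc ∑ L ∈ Finset.powersetCard K Finset.univ, y ^ (L \ L₀).card
      ≤ ∑ L ∈ (Finset.univ : Finset (Fin N)).powerset, y ^ (L \ L₀).card :=
        Finset.sum_le_sum_of_subset_of_nonneg
          (fun L _ => Finset.mem_powerset.2 (Finset.subset_univ _)) fun _ _ _ => by positivity
    _ = ∏ i : Fin N, (1 + if i ∈ L₀ then 1 else y) := by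
        rw [Finset.prod_one_add]; exact Finset.sum_congr rfl fun L _ => h1 L
    _ ≤ _ := h2
    _ = 2 ^ L₀.card * Real.exp (y * N) := by
        rw [Finset.prod_mul_distrib, Finset.prod_const, Finset.card_univ, Fintype.card_fin,
          ← Real.exp_nat_mul, mul_comm (N : ℝ)]
        congr 1
        rw [Finset.prod_ite, Finset.prod_const_one, mul_one, Finset.prod_const]
        congr 2
        ext; simp

/-- Few sign patterns on a given support are close to a given sign pattern. -/
theorem card_filter_columnPatterns_le {J N K : ℕ} {u : ℝ} (hu : 0 < u) {β₀ : Signal J N}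
    (hβ₀ : ∀ p, β₀ p = 0 ∨ β₀ p = u ∨ β₀ p = -u) {L : Finset (Fin N)} (hL : L.card = K) :
    (((columnPatterns J L u (-u)).filter fun β =>
        ∑ p, (β p - β₀ p) ^ 2 < (K * J : ℕ) * u ^ 2 / 10).card : ℝ) ≤
      Real.exp (-((K * J : ℕ) : ℝ) / 10) * 2 ^ (K * J) := by
  set s := K * J with hs
  have hne : u ≠ -u := by linarith
  -- Exponential Markov inequality: the product of these weights is at least `exp (-s / 10)` on
  -- close patterns. Its sum over all patterns factorises, each entry in `L` contributing at most
  -- `max (2 / e) (1 + exp (-4)) ≤ 3 / 2 ≤ 2 * exp (-1 / 5)`. The net gain is `exp (s / 10 - s /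
  -- 5)`.
  let w : Fin J × Fin N → ℝ → ℝ := fun p x =>
    if p.2 ∈ L then Real.exp (-(x - β₀ p) ^ 2 / u ^ 2) else 1
  have hw : ∀ p x, 0 ≤ w p x := fun p x => by simp only [w]; split_ifs <;> positivity
  have h1 : ∀ β ∈ (columnPatterns J L u (-u)).filter fun β =>
      ∑ p, (β p - β₀ p) ^ 2 < s * u ^ 2 / 10, (1 : ℝ) ≤ Real.exp (s / 10) * ∏ p, w p (β p) := by
    intro β hβ
    have hd := (Finset.mem_filter.1 hβ).2
    have h2 : Real.exp (-(∑ p, (β p - β₀ p) ^ 2) / u ^ 2) ≤ ∏ p, w p (β p) := by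
      rw [← Finset.sum_neg_distrib, Finset.sum_div, Real.exp_sum]
      refine Finset.prod_le_prod (fun p _ => by positivity) fun p _ => ?_
      simp only [w]
      split_ifs
      · exact le_rfl
      · rw [Real.exp_le_one_iff, neg_div]
        exact neg_nonpos.2 (by positivity)
    refine le_trans ?_ (mul_le_mul_of_nonneg_left h2 (Real.exp_nonneg _))
    rw [← Real.exp_add, Real.one_le_exp_iff, neg_div, ← sub_eq_add_neg, sub_nonneg,
      div_le_iff₀ (by positivity)]
    linarith
  have h3 : ∑ β ∈ columnPatterns J L u (-u), ∏ p, w p (β p) ≤ (3 / 2) ^ s := by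
    rw [columnPatterns, ← Finset.prod_univ_sum]
    have h4 : ∀ p : Fin J × Fin N, ∑ x ∈ (if p.2 ∈ L then ({u, -u} : Finset ℝ) else {0}), w p x ≤
        if p.2 ∈ L then 3 / 2 else 1 := by
      intro p
      by_cases hp : p.2 ∈ L
      · simp only [hp, if_true, Finset.sum_pair hne, w]
        have he1 : Real.exp (-1) ≤ 1 / 2 := by
          rw [Real.exp_neg, one_div]
          exact inv_anti₀ (by norm_num) (by linarith [Real.add_one_le_exp (1 : ℝ)])
        have he4 : Real.exp (-4) ≤ 1 / 2 :=
          (Real.exp_le_exp.2 (by norm_num)).trans he1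
        rcases hβ₀ p with h | h | h <;> rw [h]
        · have e1 : -(u - 0) ^ 2 / u ^ 2 = -1 := by field_simp; ring
          have e2 : -(-u - 0) ^ 2 / u ^ 2 = -1 := by field_simp; ring
          rw [e1, e2]; linarith
        · have e1 : -(u - u) ^ 2 / u ^ 2 = 0 := by simp
          have e2 : -(-u - u) ^ 2 / u ^ 2 = -4 := by field_simp; ring
          rw [e1, e2, Real.exp_zero]; linarith
        · have e1 : -(u - -u) ^ 2 / u ^ 2 = -4 := by field_simp; ring
          have e2 : -(-u - -u) ^ 2 / u ^ 2 = 0 := by simp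
          rw [e1, e2, Real.exp_zero]; linarith
      · simp [hp, w]
    refine (Finset.prod_le_prod (fun p _ => Finset.sum_nonneg fun x _ => hw p x)
      fun p _ => h4 p).trans_eq ?_
    rw [Finset.prod_ite, Finset.prod_const_one, mul_one, Finset.prod_const, card_filter_snd_mem, hL]
  have h5 : (3 / 2 : ℝ) ≤ Real.exp (-(1 / 5)) * 2 := by
    have := Real.add_one_le_exp (-(1 / 5) : ℝ)
    linarith
  calc (((columnPatterns J L u (-u)).filter fun β =>
        ∑ p, (β p - β₀ p) ^ 2 < s * u ^ 2 / 10).card : ℝ)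
      ≤ ∑ β ∈ (columnPatterns J L u (-u)).filter fun β =>
        ∑ p, (β p - β₀ p) ^ 2 < s * u ^ 2 / 10, Real.exp (s / 10) * ∏ p, w p (β p) := by
        simpa using Finset.sum_le_sum h1
    _ ≤ ∑ β ∈ columnPatterns J L u (-u), Real.exp (s / 10) * ∏ p, w p (β p) :=
        Finset.sum_le_sum_of_subset_of_nonneg (Finset.filter_subset _ _) fun β _ _ =>
          mul_nonneg (Real.exp_nonneg _) (Finset.prod_nonneg fun p _ => hw p _)
    _ ≤ Real.exp (s / 10) * (Real.exp (-(1 / 5)) * 2) ^ s := by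
        rw [← Finset.mul_sum]
        exact mul_le_mul_of_nonneg_left
          (h3.trans (pow_le_pow_left₀ (by norm_num) h5 s)) (Real.exp_nonneg _)
    _ = Real.exp (-(s : ℝ) / 10) * 2 ^ s := by
        rw [mul_pow, ← Real.exp_nat_mul, ← mul_assoc, ← Real.exp_add]
        congr 2; ring

/-- Each column of `L \ L₀` contributes `J u²` to the squared distance, so there are fewer than `K /
10` of them; one half is all that is needed later. -/
theorem card_sdiff_le_of_close {J N K : ℕ} (hJ : 1 ≤ J) {u : ℝ} (hu : 0 < u) {β β₀ : Signal J N}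
    {L L₀ : Finset (Fin N)} (hβ : β ∈ columnPatterns J L u (-u))
    (hβ₀ : β₀ ∈ columnPatterns J L₀ u (-u))
    (h : ∑ p, (β p - β₀ p) ^ 2 < (K * J : ℕ) * u ^ 2 / 10) :
    2 * ((L \ L₀).card : ℝ) ≤ K := by
  rw [mem_columnPatterns] at hβ hβ₀
  have h1 : ((L \ L₀).card * J : ℕ) * u ^ 2 ≤ ∑ p, (β p - β₀ p) ^ 2 := by
    rw [← card_filter_snd_mem, ← nsmul_eq_mul, ← Finset.sum_const, Finset.sum_filter]
    refine Finset.sum_le_sum fun p _ => ?_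
    split_ifs with hp
    · rw [Finset.mem_sdiff] at hp
      rw [show β₀ p = 0 from hβ₀.1 p.1 p.2 hp.2]
      rcases hβ.2 p.1 p.2 hp.1 with h' | h' <;> rw [show β p = _ from h'] <;> simp
    · positivity
  have h2 := h1.trans_lt h
  have hJ' : (0 : ℝ) < J := by exact_mod_cast hJ
  have h3 : (J : ℝ) * u ^ 2 * ((L \ L₀).card : ℝ) < J * u ^ 2 * (K / 10) := by
    push_cast at h2; linarith
  have h4 := lt_of_mul_lt_mul_left h3 (by positivity)
  have : (0 : ℝ) ≤ K := Nat.cast_nonneg K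
  linarith

theorem card_blockEnsembleFinset_filter_le_sum {J N K : ℕ} (u v : ℝ) (P : Signal J N → Prop)
    [DecidablePred P] :
    (((blockEnsembleFinset J N K u v).filter P).card : ℝ) ≤
      ∑ L ∈ Finset.powersetCard K Finset.univ, (((columnPatterns J L u v).filter P).card : ℝ) := by
  rw [blockEnsembleFinset, Finset.filter_biUnion]
  exact_mod_cast Finset.card_biUnion_le

/-- Only an exponentially small part of the ensemble is close to a given member. -/
theorem card_filter_blockEnsembleFinset_le {J N K : ℕ} (hJ : 1 ≤ J) (hK : 1 ≤ K) (hKN : K ≤ N)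
    {u : ℝ} (hu : 0 < u) {β₀ : Signal J N} (hβ₀ : β₀ ∈ blockEnsembleFinset J N K u (-u)) :
    (((blockEnsembleFinset J N K u (-u)).filter fun β =>
        ∑ p, (β p - β₀ p) ^ 2 < (K * J : ℕ) * u ^ 2 / 10).card : ℝ) ≤
      Real.exp (-blockSampleOrder J N K / 70) * (blockEnsembleFinset J N K u (-u)).card := by
  set m := blockSampleOrder J N K with hm
  obtain ⟨L₀, hL₀, hβ₀⟩ := mem_blockEnsembleFinset.1 hβ₀
  have hval : ∀ p, β₀ p = 0 ∨ β₀ p = u ∨ β₀ p = -u := fun p => by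
    rw [mem_columnPatterns] at hβ₀
    by_cases hp : p.2 ∈ L₀
    · exact Or.inr (hβ₀.2 p.1 p.2 hp)
    · exact Or.inl (hβ₀.1 p.1 p.2 hp)
  have hcard : ((blockEnsembleFinset J N K u (-u)).card : ℝ) = 2 ^ (K * J) * N.choose K := by
    exact_mod_cast card_blockEnsembleFinset N K hJ hu.ne' (by linarith) (by linarith)
  set ℓ := Real.log ((N : ℝ) / K) with hℓ
  have hK' : (1 : ℝ) ≤ K := by exact_mod_cast hK
  have hNK : (1 : ℝ) ≤ (N : ℝ) / K := by
    rw [le_div_iff₀ (by linarith), one_mul]; exact_mod_cast hKN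
  have hℓ0 : 0 ≤ ℓ := Real.log_nonneg hNK
  have hexpℓ : Real.exp ℓ = (N : ℝ) / K := Real.exp_log (by linarith)
  have hchoose : Real.exp (K * ℓ) ≤ N.choose K := by
    rw [Real.exp_nat_mul, hexpℓ]; exact div_pow_le_choose N K hKN
  have hms : m = (K * J : ℕ) + K * ℓ := by rw [hm, blockSampleOrder]; push_cast; rfl
  have hKs : (K : ℝ) ≤ (K * J : ℕ) := by
    exact_mod_cast Nat.le_mul_of_pos_right K hJ
  set s := K * J with hs
  have hsum := card_blockEnsembleFinset_filter_le_sum (J := J) (N := N) (K := K) u (-u)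
    fun β => ∑ p, (β p - β₀ p) ^ 2 < s * u ^ 2 / 10
  rw [hcard]
  -- If `K ℓ ≤ 6 s`, then `m ≤ 7 s` and the saving `exp (-s / 10)` from the signs is enough.
  -- Otherwise the supports must provide the saving: a close signal has at most `K / 2` columns
  -- outside `L₀`.
  rcases le_total ((K : ℝ) * ℓ) (6 * s) with hcase | hcase
  · calc (((blockEnsembleFinset J N K u (-u)).filter fun β =>
        ∑ p, (β p - β₀ p) ^ 2 < s * u ^ 2 / 10).card : ℝ)
        ≤ ∑ L ∈ Finset.powersetCard K (Finset.univ : Finset (Fin N)),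
          Real.exp (-(s : ℝ) / 10) * 2 ^ s :=
          hsum.trans (Finset.sum_le_sum fun L hL =>
            card_filter_columnPatterns_le hu hval (Finset.mem_powersetCard.1 hL).2)
      _ = Real.exp (-(s : ℝ) / 10) * (2 ^ s * N.choose K) := by
          rw [Finset.sum_const, Finset.card_powersetCard, Finset.card_univ, Fintype.card_fin,
            nsmul_eq_mul]
          ring
      _ ≤ _ := by
          refine mul_le_mul_of_nonneg_right (Real.exp_le_exp.2 ?_) (by positivity)
          rw [hms]; linarith
  · have h1 : ∀ L ∈ Finset.powersetCard K (Finset.univ : Finset (Fin N)),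
        (((columnPatterns J L u (-u)).filter fun β =>
          ∑ p, (β p - β₀ p) ^ 2 < s * u ^ 2 / 10).card : ℝ) ≤
        2 ^ s * Real.exp (K * ℓ / 2) * Real.exp (-ℓ) ^ (L \ L₀).card := by
      intro L hL
      have hLc := (Finset.mem_powersetCard.1 hL).2
      rcases Finset.eq_empty_or_nonempty ((columnPatterns J L u (-u)).filter fun β =>
          ∑ p, (β p - β₀ p) ^ 2 < s * u ^ 2 / 10) with h0 | ⟨β, hβ⟩
      · rw [h0]; simp; positivity
      · rw [Finset.mem_filter] at hβ
        have h2 := card_sdiff_le_of_close hJ hu hβ.1 hβ₀ hβ.2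
        -- This is where `|L \ L₀| ≤ K / 2` enters: supports that contribute have weight at least 1,
        -- so all supports can be summed with weights.
        have h3 : 1 ≤ Real.exp (K * ℓ / 2) * Real.exp (-ℓ) ^ (L \ L₀).card := by
          rw [← Real.exp_nat_mul, ← Real.exp_add, Real.one_le_exp_iff]
          nlinarith
        have h4 : (((columnPatterns J L u (-u)).filter fun β =>
            ∑ p, (β p - β₀ p) ^ 2 < s * u ^ 2 / 10).card : ℝ) ≤ 2 ^ s := by
          have := card_columnPatterns J L (u := u) (v := -u) (by linarith)
          rw [hLc] at this
          exact_mod_cast this ▸ Finset.card_filter_le _ _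
        rw [mul_assoc]
        exact h4.trans (le_mul_of_one_le_right (by positivity) h3)
    have h5 : Real.exp (-ℓ) * N = K := by
      have : (0 : ℝ) < N := by
        have : 0 < N := by omega
        exact_mod_cast this
      rw [Real.exp_neg, hexpℓ]; field_simp
    have h6 : (2 : ℝ) ^ K ≤ Real.exp K := by
      rw [← Real.exp_one_pow]
      exact pow_le_pow_left₀ (by norm_num) (by linarith [Real.add_one_le_exp (1 : ℝ)]) K
    calc (((blockEnsembleFinset J N K u (-u)).filter fun β =>
        ∑ p, (β p - β₀ p) ^ 2 < s * u ^ 2 / 10).card : ℝ)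
        ≤ 2 ^ s * Real.exp (K * ℓ / 2) * (2 ^ K * Real.exp K) := by
          refine (hsum.trans (Finset.sum_le_sum h1)).trans ?_
          rw [← Finset.mul_sum]
          have h7 := sum_exp_neg_card_sdiff_le (K := K) L₀ (Real.exp_nonneg (-ℓ))
          rw [h5, hL₀] at h7
          exact mul_le_mul_of_nonneg_left h7 (by positivity)
      _ ≤ 2 ^ s * Real.exp (K * ℓ / 2) * (Real.exp K * Real.exp K) := by gcongr
      _ = Real.exp (2 * K - K * ℓ / 2) * (2 ^ s * Real.exp (K * ℓ)) := by
          rw [mul_assoc, ← Real.exp_add, ← Real.exp_add, mul_left_comm (Real.exp _),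
            ← Real.exp_add]
          congr 2; ring
      _ ≤ Real.exp (-m / 70) * (2 ^ s * N.choose K) := by
          gcongr
          rw [hms]; linarith

theorem sum_sq_sub_lt_of_close {ι : Type*} [Fintype ι] {x y b : ι → ℝ} {r : ℝ}
    (hx : ∑ p, (x p - b p) ^ 2 < r) (hy : ∑ p, (y p - b p) ^ 2 < r) :
    ∑ p, (x p - y p) ^ 2 < 4 * r := by
  have h : ∑ p, (x p - y p) ^ 2 ≤ ∑ p, (2 * (x p - b p) ^ 2 + 2 * (y p - b p) ^ 2) :=
    Finset.sum_le_sum fun p _ => by nlinarith [sq_nonneg (x p - b p + (y p - b p))]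
  rw [Finset.sum_add_distrib, ← Finset.mul_sum, ← Finset.mul_sum] at h
  linarith

/-- Only an exponentially small part of the ensemble is close to a given vector. -/
theorem card_filter_close_blockEnsembleFinset_le {J N K : ℕ} (hJ : 1 ≤ J) (hK : 1 ≤ K)
    (hKN : K ≤ N) {u : ℝ} (hu : 0 < u) {r : ℝ} (hr : 4 * r ≤ (K * J : ℕ) * u ^ 2 / 10)
    (b : Signal J N) :
    (((blockEnsembleFinset J N K u (-u)).filter fun β => ∑ p, (β p - b p) ^ 2 < r).card : ℝ) ≤
      Real.exp (-blockSampleOrder J N K / 70) * (blockEnsembleFinset J N K u (-u)).card := by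
  -- The centre `b` need not belong to the ensemble. Replacing it by a close member doubles the
  -- radius, which accounts for the factor 4 in `hr`.
  rcases Finset.eq_empty_or_nonempty ((blockEnsembleFinset J N K u (-u)).filter fun β =>
      ∑ p, (β p - b p) ^ 2 < r) with h0 | ⟨β₀, hβ₀⟩
  · rw [h0]; simp; positivity
  · rw [Finset.mem_filter] at hβ₀
    refine le_trans ?_ (card_filter_blockEnsembleFinset_le hJ hK hKN hu hβ₀.1)
    exact_mod_cast Finset.card_le_card fun β hβ => by
      rw [Finset.mem_filter] at hβ ⊢
      exact ⟨hβ.1, (sum_sq_sub_lt_of_close hβ.2 hβ₀.2).trans_le hr⟩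

/-! ### Change of measure and the reduction of recovery to counting. -/

theorem lintegral_uniformOn_finset {Ω : Type*} [MeasurableSpace Ω] [MeasurableSingletonClass Ω]
    (F : Finset Ω) (g : Ω → ℝ≥0∞) :
    ∫⁻ x, g x ∂(uniformOn (F : Set Ω)) = (F.card : ℝ≥0∞)⁻¹ * ∑ x ∈ F, g x := by
  rw [uniformOn, ProbabilityTheory.cond, lintegral_smul_measure, lintegral_finset,
    Measure.count_apply_finset]
  simp

/-- Change of measure: if the laws `P i` are dominated by a common measure up to small remainders,
a Markov kernel cannot hit all of the sets `B i`. -/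
theorem sum_lintegral_kernel_le {ι Z S : Type*} [MeasurableSpace Z] [MeasurableSpace S]
    (κ : Kernel Z S) [IsMarkovKernel κ] (F : Finset ι) (P ρ : ι → Measure Z) (Q : Measure Z)
    (B : ι → Set S) (hB : ∀ i, MeasurableSet (B i)) {r ℓ : ℝ≥0∞}
    (hP : ∀ i ∈ F, P i ≤ Q + ρ i) (hρ : ∀ i ∈ F, ρ i Set.univ ≤ r)
    (hℓ : ∀ b, ∑ i ∈ F, (B i).indicator (fun _ => (1 : ℝ≥0∞)) b ≤ ℓ) :
    ∑ i ∈ F, ∫⁻ z, κ z (B i) ∂(P i) ≤ ℓ * Q Set.univ + F.card * r := by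
  have h1 : ∀ i ∈ F, ∫⁻ z, κ z (B i) ∂(P i) ≤ ∫⁻ z, κ z (B i) ∂Q + r := by
    intro i hi
    refine (lintegral_mono' (hP i hi) le_rfl).trans ?_
    rw [lintegral_add_measure]
    gcongr
    calc ∫⁻ z, κ z (B i) ∂(ρ i) ≤ ∫⁻ _, 1 ∂(ρ i) := lintegral_mono fun z => prob_le_one
      _ ≤ r := by rw [lintegral_one]; exact hρ i hi
  refine (Finset.sum_le_sum h1).trans ?_
  rw [Finset.sum_add_distrib, Finset.sum_const, nsmul_eq_mul,
    ← lintegral_finsetSum _ fun i _ => Kernel.measurable_coe κ (hB i)]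
  gcongr
  -- Under the single measure `Q`, the sum is the expected number of sets `B i` that contain the
  -- random guess, hence at most `ℓ`.
  calc ∫⁻ z, ∑ i ∈ F, κ z (B i) ∂Q ≤ ∫⁻ _, ℓ ∂Q := lintegral_mono fun z => by
        have h2 : ∀ i ∈ F, κ z (B i) = ∫⁻ b, (B i).indicator (fun _ => (1 : ℝ≥0∞)) b ∂(κ z) :=
          fun i _ => by rw [lintegral_indicator_const (hB i), one_mul]
        rw [Finset.sum_congr rfl h2,
          ← lintegral_finsetSum _ fun i _ => measurable_const.indicator (hB i)]
        calc _ ≤ ∫⁻ _, ℓ ∂(κ z) := lintegral_mono hℓ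
          _ = ℓ := by simp
    _ = ℓ * Q Set.univ := lintegral_const _

/-- Union bound that decouples the guess from the noise: `A e` is failure, and outside the event `G`
of large noise every non-failing guess lies in `B`, a set free of `e`. Hitting `B` then depends only
on the law of the data. Measurability is needed for `B` and `G` but not for `A e`. -/
theorem one_le_fail_add_hit_add_noise {Ω E Z S : Type*} [MeasurableSpace Ω] [MeasurableSpace E]
    [MeasurableSpace Z] [MeasurableSpace S] (μ : Measure Ω) [IsProbabilityMeasure μ]
    (ν : Measure E) [IsProbabilityMeasure ν] {D : Ω × E → Z} (hD : Measurable D)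
    (κ : Kernel Z S) [IsMarkovKernel κ] (A : E → Set S) {B : Set S} (hB : MeasurableSet B)
    {G : Set E} (hG : MeasurableSet G) (hcover : ∀ e ∉ G, ∀ b, b ∈ A e ∨ b ∈ B) :
    1 ≤ ∫⁻ X, ∫⁻ e, κ (D (X, e)) (A e) ∂ν ∂μ + ∫⁻ z, κ z B ∂((μ.prod ν).map D) + ν G := by
  have hκ : Measurable fun z => κ z B := Kernel.measurable_coe κ hB
  have h1 : ∀ X e, 1 ≤ κ (D (X, e)) (A e) + κ (D (X, e)) B + G.indicator (fun _ => 1) e := by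
    intro X e
    by_cases he : e ∈ G
    · rw [Set.indicator_of_mem he]; exact le_add_self
    · have h2 : A e ∪ B = Set.univ := Set.eq_univ_of_forall (hcover e he)
      calc (1 : ℝ≥0∞) = κ (D (X, e)) (A e ∪ B) := by rw [h2, measure_univ]
        _ ≤ κ (D (X, e)) (A e) + κ (D (X, e)) B := measure_union_le _ _
        _ ≤ _ := le_self_add
  have h3 : ∀ X, 1 ≤ ∫⁻ e, κ (D (X, e)) (A e) ∂ν + ∫⁻ e, κ (D (X, e)) B ∂ν + ν G := by
    intro X
    have hm : Measurable fun e => κ (D (X, e)) B :=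
      hκ.comp (hD.comp measurable_prodMk_left)
    rw [← lintegral_add_right _ hm, ← one_mul (ν G), ← lintegral_indicator_const hG,
      ← lintegral_add_right _ (measurable_const.indicator hG)]
    calc (1 : ℝ≥0∞) = ∫⁻ _, 1 ∂ν := by simp
      _ ≤ _ := lintegral_mono (h1 X)
  rw [lintegral_map hκ hD, lintegral_prod (fun a => κ (D a) B) (hκ.comp hD).aemeasurable]
  have hm : Measurable fun X => ∫⁻ e, κ (D (X, e)) B ∂ν := (hκ.comp hD).lintegral_prod_right'
  rw [← lintegral_add_right _ hm]
  calc (1 : ℝ≥0∞) = ∫⁻ _, 1 ∂μ := by simp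
    _ ≤ ∫⁻ X, (∫⁻ e, κ (D (X, e)) (A e) ∂ν + ∫⁻ e, κ (D (X, e)) B ∂ν + ν G) ∂μ :=
        lintegral_mono h3
    _ = _ := by rw [lintegral_add_right _ measurable_const]; simp

theorem sum_sq_lt_of_l2norm_lt {ι ι' : Type*} [Fintype ι] [Fintype ι'] {x : ι → ℝ} {e : ι' → ℝ}
    {C C₀ R : ℝ} (hC : 0 < C) (hC₀ : C ≤ C₀) (h : l2norm x < C * l2norm e)
    (he : ∑ i, e i ^ 2 < R) : ∑ i, x i ^ 2 < C₀ ^ 2 * R := by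
  have hx : l2norm x ^ 2 = ∑ i, x i ^ 2 := Real.sq_sqrt (Finset.sum_nonneg fun _ _ => sq_nonneg _)
  have he' : l2norm e ^ 2 = ∑ i, e i ^ 2 :=
    Real.sq_sqrt (Finset.sum_nonneg fun _ _ => sq_nonneg _)
  have h0 : 0 ≤ l2norm x := Real.sqrt_nonneg _
  calc ∑ i, x i ^ 2 = l2norm x ^ 2 := hx.symm
    _ < (C * l2norm e) ^ 2 := pow_lt_pow_left₀ h h0 two_ne_zero
    _ = C ^ 2 * ∑ i, e i ^ 2 := by rw [mul_pow, he']
    _ ≤ C ^ 2 * R := by gcongr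
    _ ≤ C₀ ^ 2 * R := by
        have : 0 ≤ R := (Finset.sum_nonneg fun _ _ => sq_nonneg _).trans he.le
        gcongr

/-- Lower bound for the error probability of inference from the data `D β (X, e)`. -/
theorem one_le_lintegral_error_add {n J N : ℕ} {Z : Type*} [MeasurableSpace Z]
    (F : Finset (Signal J N)) (hF : F.Nonempty) (μ : Measure (Design n J N))
    [IsProbabilityMeasure μ] (ν : Measure (Fin n → ℝ)) [IsProbabilityMeasure ν]
    {D : Signal J N → Design n J N × (Fin n → ℝ) → Z} (hD : ∀ β, Measurable (D β))
    (κ : Kernel Z (Signal J N)) [IsMarkovKernel κ] {C C₀ R : ℝ} (hC : 0 < C) (hC₀ : C ≤ C₀)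
    (Q : Measure Z) (ρ : Signal J N → Measure Z) {r ℓ p : ℝ≥0∞}
    (hP : ∀ β ∈ F, (μ.prod ν).map (D β) ≤ Q + ρ β) (hρ : ∀ β ∈ F, ρ β Set.univ ≤ r)
    (hℓ : ∀ b : Signal J N, ((F.filter fun β => ∑ q, (β q - b q) ^ 2 < C₀ ^ 2 * R).card : ℝ≥0∞) ≤ ℓ)
    (hp : ν {e | R ≤ ∑ i, e i ^ 2} ≤ p) :
    1 ≤ ∫⁻ β, ∫⁻ X, ∫⁻ e, κ (D β (X, e)) {b | C * l2norm e ≤ l2norm (β - b)} ∂ν ∂μ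
      ∂(uniformOn (F : Set (Signal J N))) + (ℓ * Q Set.univ / F.card + r + p) := by
  -- When `‖e‖² < R` and `C ≤ C₀`, success forces the guess into this ball around `β`, whose radius
  -- no longer involves the noise.
  set B : Signal J N → Set (Signal J N) := fun β => {b | ∑ q, (β q - b q) ^ 2 < C₀ ^ 2 * R}
  have hB : ∀ β, MeasurableSet (B β) := fun β => measurableSet_lt (by fun_prop) (by fun_prop)
  have hG : MeasurableSet {e : Fin n → ℝ | R ≤ ∑ i, e i ^ 2} :=
    measurableSet_le (by fun_prop) (by fun_prop)
  have h1 := fun β => one_le_fail_add_hit_add_noise μ ν (hD β) κ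
    (fun e => {b | C * l2norm e ≤ l2norm (β - b)}) (hB β) hG fun e he b => by
      simp only [Set.mem_ofPred_eq, not_le] at he ⊢
      rcases le_or_gt (C * l2norm e) (l2norm (β - b)) with h | h
      · exact Or.inl h
      · exact Or.inr (sum_sq_lt_of_l2norm_lt hC hC₀ h he)
  have h2 := sum_lintegral_kernel_le κ F (fun β => (μ.prod ν).map (D β)) ρ Q B hB hP hρ
    (ℓ := ℓ) fun b => by
      refine le_trans (le_of_eq ?_) (hℓ b)
      rw [Finset.card_filter]
      push_cast
      exact Finset.sum_congr rfl fun β _ => by simp [B, Set.indicator_apply]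
  set a : Signal J N → ℝ≥0∞ := fun β =>
    ∫⁻ X, ∫⁻ e, κ (D β (X, e)) {b | C * l2norm e ≤ l2norm (β - b)} ∂ν ∂μ with ha
  have h3 : (F.card : ℝ≥0∞) ≤ ∑ β ∈ F, a β + (ℓ * Q Set.univ + F.card * r) + F.card * p := by
    calc (F.card : ℝ≥0∞) = ∑ β ∈ F, 1 := by simp
      _ ≤ ∑ β ∈ F, (a β + ∫⁻ z, κ z (B β) ∂((μ.prod ν).map (D β)) + p) :=
          Finset.sum_le_sum fun β _ => (h1 β).trans (by gcongr)
      _ = ∑ β ∈ F, a β + ∑ β ∈ F, ∫⁻ z, κ z (B β) ∂((μ.prod ν).map (D β)) + F.card * p := by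
          rw [Finset.sum_add_distrib, Finset.sum_add_distrib, Finset.sum_const, nsmul_eq_mul]
      _ ≤ _ := by gcongr
  have hc0 : (F.card : ℝ≥0∞) ≠ 0 := by simpa using hF.ne_empty
  have hct : (F.card : ℝ≥0∞) ≠ ∞ := ENNReal.natCast_ne_top _
  rw [lintegral_uniformOn_finset]
  calc (1 : ℝ≥0∞) = (F.card : ℝ≥0∞)⁻¹ * F.card := (ENNReal.inv_mul_cancel hc0 hct).symm
    _ ≤ (F.card : ℝ≥0∞)⁻¹ * (∑ β ∈ F, a β + (ℓ * Q Set.univ + F.card * r) + F.card * p) := by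
        gcongr
    _ = (F.card : ℝ≥0∞)⁻¹ * ∑ β ∈ F, a β + (ℓ * Q Set.univ / F.card
          + (F.card : ℝ≥0∞)⁻¹ * F.card * r + (F.card : ℝ≥0∞)⁻¹ * F.card * p) := by
        rw [ENNReal.div_eq_inv_mul]; ring
    _ = _ := by rw [ENNReal.inv_mul_cancel hc0 hct, one_mul, one_mul]

theorem noisyErrorKnownDesign_eq_lintegral {n J N : ℕ} (F : Set (Signal J N))
    (μ : Measure (Design n J N)) (ν : Measure (Fin n → ℝ)) {f : (Fin n → ℝ) → (Fin n → ℝ)}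
    (hf : Measurable f) (κ : Kernel (Design n J N × (Fin n → ℝ)) (Signal J N)) (C : ℝ) :
    noisyErrorKnownDesign F μ ν f κ C = ∫⁻ β, ∫⁻ X, ∫⁻ e,
      κ.comap (Prod.map id f) (measurable_id.prodMap hf) (X, designMul X β + e)
        {b | C * l2norm e ≤ l2norm (β - b)} ∂ν ∂μ ∂(uniformOn F) := rfl

theorem noisyError_eq_lintegral {n J N : ℕ} (F : Set (Signal J N))
    (μ : Measure (Design n J N)) (ν : Measure (Fin n → ℝ)) {f : (Fin n → ℝ) → (Fin n → ℝ)}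
    (hf : Measurable f) (κ : Kernel (Fin n → ℝ) (Signal J N)) (C : ℝ) :
    noisyError F μ ν f κ C = ∫⁻ β, ∫⁻ X, ∫⁻ e, κ.comap f hf (designMul X β + e)
        {b | C * l2norm e ≤ l2norm (β - b)} ∂ν ∂μ ∂(uniformOn F) := rfl

theorem nonempty_blockEnsembleFinset {J N K : ℕ} (hKN : K ≤ N) (u v : ℝ) :
    (blockEnsembleFinset J N K u v).Nonempty := by
  obtain ⟨L, -, hL⟩ := Finset.exists_subset_card_eq (s := (Finset.univ : Finset (Fin N)))
    (n := K) (by simpa using hKN)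
  exact ⟨fun p => if p.2 ∈ L then u else 0, mem_blockEnsembleFinset.2 ⟨L, hL,
    mem_columnPatterns.2 ⟨fun i j hj => by simp [hj], fun i j hj => by simp [hj]⟩⟩⟩

/-- Without observations the noise vanishes, so that the recovery guarantee fails. -/
theorem lintegral_error_zero_observations {J N : ℕ} {Z : Type*} [MeasurableSpace Z]
    (F : Finset (Signal J N)) (hF : F.Nonempty) (μ : Measure (Design 0 J N))
    [IsProbabilityMeasure μ] (ν : Measure (Fin 0 → ℝ)) [IsProbabilityMeasure ν]
    (D : Signal J N → Design 0 J N × (Fin 0 → ℝ) → Z)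
    (κ : Kernel Z (Signal J N)) [IsMarkovKernel κ] (C : ℝ) :
    ∫⁻ β, ∫⁻ X, ∫⁻ e, κ (D β (X, e)) {b | C * l2norm e ≤ l2norm (β - b)} ∂ν ∂μ
      ∂(uniformOn (F : Set (Signal J N))) = 1 := by
  have h : ∀ (β : Signal J N) (e : Fin 0 → ℝ), {b | C * l2norm e ≤ l2norm (β - b)} = Set.univ :=
    fun β e => Set.eq_univ_of_forall fun b => by simp [l2norm, Real.sqrt_nonneg]
  have := isProbabilityMeasure_uniformOn (Finset.finite_toSet F) hF
  simp [h]

/-! ### Lower bounds when the design is not observed. -/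

/-- The law of `X β` for a Gaussian design `X` and a signal `β` with `s` entries in `{u, v}`, of which
`j` are equal to `v`. -/
def countLaw (n s : ℕ) (m : ℝ) (τ : ℝ≥0) (u v : ℝ) (j : ℕ) : Measure (Fin n → ℝ) :=
  Measure.pi fun _ => gaussianReal (m * (((s : ℝ) - j) * u + j * v))
    (τ * Real.toNNReal (((s : ℝ) - j) * u ^ 2 + j * v ^ 2))

instance isProbabilityMeasure_countLaw (n s : ℕ) (m : ℝ) (τ : ℝ≥0) (u v : ℝ) (j : ℕ) :
    IsProbabilityMeasure (countLaw n s m τ u v j) := by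
  unfold countLaw; infer_instance

theorem exists_map_designMul_eq_countLaw {n J N K : ℕ} (m : ℝ) (τ : ℝ≥0) {u v : ℝ}
    {β : Signal J N} (hβ : β ∈ blockEnsembleFinset J N K u v) :
    ∃ j ∈ Finset.range (K * J + 1), (gaussianDesign n J N m τ).map (fun X => designMul X β) =
      countLaw n (K * J) m τ u v j := by
  obtain ⟨j, hj, h⟩ := exists_count_of_mem_blockEnsembleFinset hβ
  refine ⟨j, Finset.mem_range.2 (by omega), ?_⟩
  rw [map_designMul_gaussianDesign, h (fun x => x) rfl, h (fun x => x ^ 2) (by norm_num)]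
  rfl

theorem measure_le_sum {Z ι : Type*} [MeasurableSpace Z] {s : Finset ι} (Q : ι → Measure Z) {j : ι}
    (hj : j ∈ s) : Q j ≤ ∑ i ∈ s, Q i := by
  refine Measure.le_iff.2 fun A _ => ?_
  rw [Measure.finsetSum_apply]
  exact Finset.single_le_sum (f := fun i => Q i A) (fun _ _ => zero_le) hj

theorem sum_probabilityMeasure_univ {Z ι : Type*} [MeasurableSpace Z] (s : Finset ι)
    (Q : ι → Measure Z) [∀ i, IsProbabilityMeasure (Q i)] : (∑ i ∈ s, Q i) Set.univ = s.card := by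
  rw [Measure.finsetSum_apply]; simp

theorem one_tenth_le_of_one_le_add {a : ℝ≥0∞} {x : ℝ} (h : 1 ≤ a + ENNReal.ofReal x)
    (hx : x ≤ 9 / 10) : 1 / 10 ≤ a := by
  have h1 : (1 / 10 : ℝ≥0∞) + ENNReal.ofReal (9 / 10) = 1 := by
    have : (1 / 10 : ℝ≥0∞) = ENNReal.ofReal (1 / 10) := by
      rw [ENNReal.ofReal_div_of_pos (by norm_num)]; simp
    rw [this, ← ENNReal.ofReal_add (by norm_num) (by norm_num)]
    norm_num
  refine (ENNReal.add_le_add_iff_right (ENNReal.ofReal_ne_top (r := 9 / 10))).1 ?_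
  rw [h1]
  exact h.trans (by gcongr)

/-- A guess equals at most one signal, so the counting bound applies with `ℓ = 1`: the success
probabilities sum to at most the mass of `Q`, which is at most half of `F.card`. -/
theorem half_le_noiselessError {n J N : ℕ} (F : Finset (Signal J N))
    (μ : Measure (Design n J N)) [IsProbabilityMeasure μ] {f : (Fin n → ℝ) → (Fin n → ℝ)}
    (hf : Measurable f) (κ : Kernel (Fin n → ℝ) (Signal J N)) [IsMarkovKernel κ]
    (Q : Measure (Fin n → ℝ)) (hP : ∀ β ∈ F, μ.map (fun X => designMul X β) ≤ Q)
    (hQ : 2 * Q Set.univ ≤ F.card) (hF : F.Nonempty) :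
    1 / 2 ≤ noiselessError (F : Set (Signal J N)) μ f κ := by
  set a : Signal J N → ℝ≥0∞ := fun β => ∫⁻ X, κ (f (designMul X β)) {b | b ≠ β} ∂μ with ha
  have h1 : ∀ β, 1 = a β + ∫⁻ z, κ.comap f hf z {β} ∂(μ.map fun X => designMul X β) := by
    intro β
    rw [lintegral_map (Kernel.measurable_coe _ (measurableSet_singleton β))
      (measurable_designMul β), ha]
    simp only [Kernel.comap_apply]
    have hm : Measurable fun X : Design n J N => κ (f (designMul X β)) {β} :=
      (Kernel.measurable_coe κ (measurableSet_singleton β)).comp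
        (hf.comp (measurable_designMul β))
    rw [← lintegral_add_right _ hm]
    have h2 : ∀ z, κ z {b | b ≠ β} + κ z {β} = 1 := fun z => by
      have := measure_add_measure_compl (μ := κ z) (measurableSet_singleton β)
      rw [measure_univ, add_comm] at this
      exact this
    simp [h2]
  have h3 := sum_lintegral_kernel_le (κ.comap f hf) F
    (fun β => μ.map fun X => designMul X β) (fun _ => 0) Q (fun β => {β})
    (fun β => measurableSet_singleton β) (r := 0) (ℓ := 1)
    (fun β hβ => by simpa using hP β hβ) (fun _ _ => by simp) fun b => by
      classical
      simp only [Set.indicator_apply, Set.mem_singleton_iff, Finset.sum_ite_eq]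
      split_ifs <;> simp
  rw [one_mul, mul_zero, add_zero] at h3
  have hc0 : (F.card : ℝ≥0∞) ≠ 0 := by simpa using hF.ne_empty
  have hct : (F.card : ℝ≥0∞) ≠ ∞ := ENNReal.natCast_ne_top _
  have h4 : (F.card : ℝ≥0∞) ≤ ∑ β ∈ F, a β + Q Set.univ := by
    calc (F.card : ℝ≥0∞) = ∑ β ∈ F, 1 := by simp
      _ = ∑ β ∈ F, (a β + ∫⁻ z, κ.comap f hf z {β} ∂(μ.map fun X => designMul X β)) :=
        Finset.sum_congr rfl fun β _ => h1 β
      _ ≤ _ := by rw [Finset.sum_add_distrib]; gcongr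
  have hQt : Q Set.univ ≠ ∞ := fun h => by simp [h] at hQ
  have h5 : (F.card : ℝ≥0∞) ≤ 2 * ∑ β ∈ F, a β := by
    refine (ENNReal.add_le_add_iff_right hct).1 ?_
    calc (F.card : ℝ≥0∞) + F.card = 2 * F.card := (two_mul _).symm
      _ ≤ 2 * (∑ β ∈ F, a β + Q Set.univ) := by gcongr
      _ = 2 * ∑ β ∈ F, a β + 2 * Q Set.univ := mul_add _ _ _
      _ ≤ _ := by gcongr
  rw [noiselessError, lintegral_uniformOn_finset, one_div]
  calc (2 : ℝ≥0∞)⁻¹ = 2⁻¹ * ((F.card : ℝ≥0∞)⁻¹ * F.card) := by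
        rw [ENNReal.inv_mul_cancel hc0 hct, mul_one]
    _ ≤ 2⁻¹ * ((F.card : ℝ≥0∞)⁻¹ * (2 * ∑ β ∈ F, a β)) := by gcongr
    _ = (2⁻¹ * 2) * ((F.card : ℝ≥0∞)⁻¹ * ∑ β ∈ F, a β) := by ring
    _ = _ := by rw [ENNReal.inv_mul_cancel two_ne_zero (by simp), one_mul]

/-- The mean and the variance of the entries play no role, since the law of `X β` is always one of
`K J + 1`. The bound on `n` serves only to give `n = 0` or a sample order of at least 100. -/
theorem noiseless_necessary_samples {J N K n : ℕ} (hJ : 1 ≤ J) (hK : 1 ≤ K) (hKN : K ≤ N)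
    (hn : (n : ℝ) ≤ 1 / 100 * blockSampleOrder J N K) {f : (Fin n → ℝ) → (Fin n → ℝ)}
    (hf : Measurable f) (κ : Kernel (Fin n → ℝ) (Signal J N)) [IsMarkovKernel κ]
    {u v : ℝ} (hu : u ≠ 0) (hv : v ≠ 0) (huv : u ≠ v) (m : ℝ) (τ : ℝ≥0) :
    1 / 2 ≤ noiselessError (blockEnsemble J N K u v) (gaussianDesign n J N m τ) f κ := by
  rw [← coe_blockEnsembleFinset]
  have hF := nonempty_blockEnsembleFinset (J := J) hKN u v
  have hcard := card_blockEnsembleFinset N K hJ hu hv huv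
  rcases Nat.eq_zero_or_pos n with rfl | hn0
  · refine half_le_noiselessError _ _ hf κ
      ((gaussianDesign 0 J N m τ).map fun X => designMul X 0) (fun β _ => ?_) ?_ hF
    · have : (fun X : Design 0 J N => designMul X β) = fun X => designMul X 0 :=
        funext fun X => Subsingleton.elim _ _
      rw [this]
    · rw [Measure.map_apply (measurable_designMul 0) MeasurableSet.univ, Set.preimage_univ,
        measure_univ, mul_one, hcard]
      have h1 : 2 ^ 1 ≤ 2 ^ (K * J) := Nat.pow_le_pow_right (by norm_num) (Nat.mul_pos hK hJ)
      have h2 := Nat.mul_le_mul h1 (Nat.choose_pos hKN)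
      exact_mod_cast h2
  · have hn1 : (1 : ℝ) ≤ n := by exact_mod_cast hn0
    refine half_le_noiselessError _ _ hf κ
      (∑ j ∈ Finset.range (K * J + 1), countLaw n (K * J) m τ u v j) (fun β hβ => ?_) ?_ hF
    · obtain ⟨j, hj, h⟩ := exists_map_designMul_eq_countLaw (n := n) m τ hβ
      rw [h]
      exact measure_le_sum _ hj
    · rw [sum_probabilityMeasure_univ, Finset.card_range, hcard]
      exact_mod_cast two_mul_count_le_card (J := J) hK hKN (by linarith)

/-- The values `0`, `u`, `v` are at mutual distance at least `u`, whereas two members close to `b`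
would have squared distance below `4 r ≤ u²`. -/
theorem card_filter_le_one_of_separated {J N K : ℕ} {u v : ℝ} (hu : 0 < u) (hv : 2 * u ≤ v)
    {r : ℝ} (hr : 4 * r ≤ u ^ 2) (b : Signal J N) :
    ((blockEnsembleFinset J N K u v).filter fun β => ∑ p, (β p - b p) ^ 2 < r).card ≤ 1 := by
  have hval : ∀ β ∈ blockEnsembleFinset J N K u v, ∀ p, β p = 0 ∨ β p = u ∨ β p = v := by
    intro β hβ p
    obtain ⟨L, -, hβ⟩ := mem_blockEnsembleFinset.1 hβ
    rw [mem_columnPatterns] at hβ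
    by_cases hp : p.2 ∈ L
    · exact Or.inr (hβ.2 p.1 p.2 hp)
    · exact Or.inl (hβ.1 p.1 p.2 hp)
  refine Finset.card_le_one.2 fun β hβ β' hβ' => ?_
  rw [Finset.mem_filter] at hβ hβ'
  by_contra hne
  obtain ⟨p, hp⟩ := Function.ne_iff.1 hne
  have h1 := sum_sq_sub_lt_of_close hβ.2 hβ'.2
  have h2 : (β p - β' p) ^ 2 ≤ ∑ p, (β p - β' p) ^ 2 :=
    Finset.single_le_sum (f := fun p => (β p - β' p) ^ 2) (fun _ _ => sq_nonneg _)
      (Finset.mem_univ p)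
  have h3 : u ^ 2 ≤ (β p - β' p) ^ 2 := by
    rcases hval β hβ.1 p with h | h | h <;> rcases hval β' hβ'.1 p with h' | h' | h' <;>
      rw [h, h'] at hp ⊢ <;> first | exact absurd rfl hp | nlinarith
  linarith

theorem map_designMul_add {n J N : ℕ} (μ : Measure (Design n J N)) [IsProbabilityMeasure μ]
    (ν : Measure (Fin n → ℝ)) [IsProbabilityMeasure ν] (β : Signal J N) :
    (μ.prod ν).map (fun q => designMul q.1 β + q.2) =
      ((μ.map fun X => designMul X β).prod ν).map fun q => q.1 + q.2 := by
  have h := Measure.map_prod_map μ ν (measurable_designMul β) measurable_id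
  rw [Measure.map_id] at h
  rw [h, Measure.map_map (by fun_prop) ((measurable_designMul β).prodMap measurable_id)]
  rfl

/-- Adding independent noise still leaves only `K J + 1` laws for the data. The bound on `n` is also
used to keep the noise below the separation of the ensemble. -/
theorem noisy_necessary_samples {J N K n : ℕ} {σ : ℝ≥0} {C₀ u v : ℝ} (hJ : 1 ≤ J) (hK : 1 ≤ K)
    (hKN : K ≤ N) (hσ : 0 < σ) (hC₀ : 0 < C₀) (hu : u = C₀ * σ * Real.sqrt (J * N))
    (hv : 2 * u ≤ v) (hn : (n : ℝ) ≤ 1 / 100 * blockSampleOrder J N K)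
    {f : (Fin n → ℝ) → (Fin n → ℝ)} (hf : Measurable f) (κ : Kernel (Fin n → ℝ) (Signal J N))
    [IsMarkovKernel κ] {C : ℝ} (hC : 0 < C) (hCC₀ : C ≤ C₀) :
    1 / 10 ≤ noisyError (blockEnsemble J N K u v) (gaussianDesign n J N 0 1)
      (gaussianNoise n σ) f κ C := by
  have hF := nonempty_blockEnsembleFinset (J := J) hKN u v
  rw [← coe_blockEnsembleFinset, noisyError_eq_lintegral _ _ _ hf]
  rcases Nat.eq_zero_or_pos n with rfl | hn0
  · rw [lintegral_error_zero_observations _ hF _ _ (fun β q => designMul q.1 β + q.2)]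
    rw [one_div]; exact ENNReal.inv_le_one.2 (by norm_num)
  have hn1 : (1 : ℝ) ≤ n := by exact_mod_cast hn0
  have hσ' : (0 : ℝ) < σ := hσ
  have hd : (0 : ℝ) < J * N := by
    have : 0 < J * N := Nat.mul_pos hJ (by omega)
    exact_mod_cast this
  have hu0 : 0 < u := by rw [hu]; positivity
  have hu2 : u ^ 2 = C₀ ^ 2 * σ ^ 2 * (J * N) := by
    rw [hu, mul_pow, mul_pow, Real.sq_sqrt hd.le]
  -- The threshold `R = σ² d / 4` for the noise energy satisfies `4 C₀² R = u²`, so each guess is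
  -- close to at most one signal. As `n ≤ 2 d / 100`, Markov's inequality bounds the exceptional
  -- probability by `8 / 100`.
  have hR : (0 : ℝ) < σ ^ 2 * (J * N) / 4 := by positivity
  let Q : ℕ → Measure (Fin n → ℝ) := fun j =>
    ((countLaw n (K * J) 0 1 u v j).prod (gaussianNoise n σ)).map fun q => q.1 + q.2
  have hQ : ∀ j, IsProbabilityMeasure (Q j) := fun j =>
    Measure.isProbabilityMeasure_map (Measurable.aemeasurable (by fun_prop))
  have h := one_le_lintegral_error_add (blockEnsembleFinset J N K u v) hF
    (gaussianDesign n J N 0 1) (gaussianNoise n σ) (D := fun β q => designMul q.1 β + q.2)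
    (fun β => ((measurable_designMul β).comp measurable_fst).add measurable_snd)
    (κ.comap f hf) hC hCC₀ (R := (σ : ℝ) ^ 2 * ((J : ℝ) * N) / 4) (∑ j ∈ Finset.range (K * J + 1), Q j)
    (fun _ => 0) (r := 0) (ℓ := 1) (p := ENNReal.ofReal (8 / 100))
    (fun β hβ => by
      obtain ⟨j, hj, h⟩ := exists_map_designMul_eq_countLaw (n := n) 0 1 hβ
      rw [map_designMul_add, h, add_zero]
      exact measure_le_sum Q hj)
    (fun _ _ => by simp)
    (fun b => by
      exact Nat.cast_le_one.2 (card_filter_le_one_of_separated hu0 hv (by rw [hu2]; linarith) b))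
    (by
      refine (pi_gaussianReal_sum_sq_ge_le n (σ ^ 2) hR).trans (ENNReal.ofReal_le_ofReal ?_)
      have := blockSampleOrder_le (J := J) hJ hK hKN
      push_cast
      rw [div_le_iff₀ hR]
      have h1 : (n : ℝ) ≤ 2 / 100 * (J * N) := by linarith
      calc (n : ℝ) * σ ^ 2 ≤ 2 / 100 * (J * N) * σ ^ 2 := by gcongr
        _ = _ := by ring)
  have hhalf : 1 * (∑ j ∈ Finset.range (K * J + 1), Q j) Set.univ /
      ((blockEnsembleFinset J N K u v).card : ℝ≥0∞) ≤ ENNReal.ofReal (1 / 2) := by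
    rw [one_mul, sum_probabilityMeasure_univ, Finset.card_range,
      card_blockEnsembleFinset N K hJ hu0.ne' (by linarith) (by linarith)]
    have h2 := two_mul_count_le_card (J := J) hK hKN (by linarith)
    have h3 : ENNReal.ofReal (1 / 2) = 2⁻¹ := by
      rw [one_div, ENNReal.ofReal_inv_of_pos (by norm_num)]; simp
    rw [h3]
    refine ENNReal.div_le_of_le_mul ?_
    rw [mul_comm (2⁻¹ : ℝ≥0∞), ← div_eq_mul_inv, ENNReal.le_div_iff_mul_le (by simp) (by simp),
      mul_comm]
    exact_mod_cast h2
  refine one_tenth_le_of_one_le_add (x := 1 / 2 + 8 / 100) (h.trans ?_) (by norm_num)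
  rw [ENNReal.ofReal_add (by norm_num) (by norm_num), add_zero]
  gcongr

/-! ### Lower bound when the design is observed. -/

theorem gaussianReal_eq_withDensity_gaussianReal (a : ℝ) {w w' : ℝ≥0} (hw : w ≠ 0) (hw' : w' ≠ 0) :
    gaussianReal a w = (gaussianReal 0 w').withDensity fun x =>
      ENNReal.ofReal (Real.sqrt (w' / w) * Real.exp (x ^ 2 / (2 * w') - (x - a) ^ 2 / (2 * w))) := by
  have hw0 : (0 : ℝ) < w := by positivity
  have hw0' : (0 : ℝ) < w' := by positivity
  rw [gaussianReal_of_var_ne_zero _ hw, gaussianReal_of_var_ne_zero _ hw',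
    ← withDensity_mul _ (measurable_gaussianPDF _ _) (by fun_prop)]
  congr 1
  ext x
  rw [Pi.mul_apply, gaussianPDF, gaussianPDF, ← ENNReal.ofReal_mul (gaussianPDFReal_nonneg _ _ _),
    gaussianPDFReal, gaussianPDFReal]
  congr 1
  have h1 : (Real.sqrt (2 * Real.pi * w'))⁻¹ * Real.sqrt (w' / w) = (Real.sqrt (2 * Real.pi * w))⁻¹ := by
    rw [← Real.sqrt_inv, ← Real.sqrt_mul (by positivity), ← Real.sqrt_inv]
    congr 1
    field_simp
  rw [mul_mul_mul_comm, h1, ← Real.exp_add]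
  congr 2
  field_simp
  ring

/-- On a ball, a Gaussian vector is dominated by a centred Gaussian vector of larger variance. -/
theorem pi_gaussianReal_inter_ball_le {n : ℕ} (a : Fin n → ℝ) {w w' : ℝ≥0} (hw : w ≠ 0)
    (hw' : w' ≠ 0) (t : ℝ) {A : Set (Fin n → ℝ)} (hA : MeasurableSet A) :
    (Measure.pi fun i => gaussianReal (a i) w) (A ∩ {x | ∑ i, x i ^ 2 ≤ t}) ≤
      ENNReal.ofReal (Real.sqrt (w' / w) ^ n * Real.exp (t / (2 * w'))) *
        (Measure.pi fun _ : Fin n => gaussianReal 0 w') A := by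
  have hB : MeasurableSet {x : Fin n → ℝ | ∑ i, x i ^ 2 ≤ t} :=
    measurableSet_le (by fun_prop) (by fun_prop)
  let g : Fin n → ℝ → ℝ := fun i x =>
    Real.sqrt (w' / w) * Real.exp (x ^ 2 / (2 * w') - (x - a i) ^ 2 / (2 * w))
  have hg : ∀ i, gaussianReal (a i) w = (gaussianReal 0 w').withDensity
      fun x => ENNReal.ofReal (g i x) :=
    fun i => gaussianReal_eq_withDensity_gaussianReal (a i) hw hw'
  have hsf : ∀ i, SigmaFinite ((gaussianReal 0 w').withDensity
      fun x => ENNReal.ofReal (g i x)) := fun i => by rw [← hg i]; infer_instance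
  have h1 : (Measure.pi fun i => gaussianReal (a i) w) =
      (Measure.pi fun _ : Fin n => gaussianReal 0 w').withDensity
        fun x => ∏ i, ENNReal.ofReal (g i (x i)) := by
    rw [← pi_withDensity (fun _ : Fin n => gaussianReal 0 w')
      (f := fun i x => ENNReal.ofReal (g i x)) (fun i => by fun_prop)]
    congr 1
    exact funext hg
  rw [h1, withDensity_apply _ (hA.inter hB)]
  have h2 : ∀ x ∈ A ∩ {x | ∑ i, x i ^ 2 ≤ t}, ∏ i, ENNReal.ofReal (g i (x i)) ≤
      ENNReal.ofReal (Real.sqrt (w' / w) ^ n * Real.exp (t / (2 * w'))) := by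
    intro x hx
    have h3 : ∑ i, x i ^ 2 ≤ t := hx.2
    rw [← ENNReal.ofReal_prod_of_nonneg fun i _ => by positivity]
    refine ENNReal.ofReal_le_ofReal ?_
    simp only [g]
    rw [Finset.prod_mul_distrib, Finset.prod_const, Finset.card_univ, Fintype.card_fin,
      ← Real.exp_sum]
    gcongr
    -- Dropping the square centred at `a` makes the bound uniform in the mean, hence later in the
    -- design and the signal.
    calc ∑ i, (x i ^ 2 / (2 * w') - (x i - a i) ^ 2 / (2 * w))
        ≤ ∑ i, x i ^ 2 / (2 * w') := Finset.sum_le_sum fun i _ => sub_le_self _ (by positivity)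
      _ = (∑ i, x i ^ 2) / (2 * w') := (Finset.sum_div _ _ _).symm
      _ ≤ t / (2 * w') := by gcongr
  calc ∫⁻ x in A ∩ {x | ∑ i, x i ^ 2 ≤ t}, ∏ i, ENNReal.ofReal (g i (x i))
        ∂(Measure.pi fun _ : Fin n => gaussianReal 0 w')
      ≤ ∫⁻ _ in A ∩ {x | ∑ i, x i ^ 2 ≤ t},
          ENNReal.ofReal (Real.sqrt (w' / w) ^ n * Real.exp (t / (2 * w')))
          ∂(Measure.pi fun _ : Fin n => gaussianReal 0 w') :=
        setLIntegral_mono measurable_const h2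
    _ ≤ _ := by
        rw [setLIntegral_const]
        gcongr
        exact Set.inter_subset_left

theorem map_const_add_pi_gaussianReal {n : ℕ} (a : Fin n → ℝ) (w : ℝ≥0) :
    (Measure.pi fun _ : Fin n => gaussianReal 0 w).map (fun e => a + e) =
      Measure.pi fun i => gaussianReal (a i) w := by
  have h0 : ∀ i, (gaussianReal 0 w).map (fun y => a i + y) = gaussianReal (a i) w := fun i => by
    rw [gaussianReal_map_const_add, zero_add]
  have h := Measure.pi_map_pi (ι := Fin n) (μ := fun _ => gaussianReal 0 w)
    (f := fun i y => a i + y) (hμ := fun i => by rw [h0]; infer_instance)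
    (fun i => Measurable.aemeasurable (by fun_prop))
  simp only [h0] at h
  exact h

theorem measurable_knownDesign {n J N : ℕ} (β : Signal J N) :
    Measurable fun q : Design n J N × (Fin n → ℝ) => (q.1, designMul q.1 β + q.2) :=
  measurable_fst.prodMk (((measurable_designMul β).comp measurable_fst).add measurable_snd)

/-- Conditionally on `X` the observation is Gaussian with mean `X β`. Since the bound on the ball
does not depend on the mean, it integrates over `X`, and the dominating measure makes `z`
independent of `X` and free of `β`. -/
theorem map_knownDesign_restrict_le {n J N : ℕ} (μ : Measure (Design n J N))
    [IsProbabilityMeasure μ] (β : Signal J N) {w w' : ℝ≥0} (hw : w ≠ 0) (hw' : w' ≠ 0) (t : ℝ) :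
    ((μ.prod (Measure.pi fun _ : Fin n => gaussianReal 0 w)).map
        fun q => (q.1, designMul q.1 β + q.2)).restrict {q | ∑ i, q.2 i ^ 2 ≤ t} ≤
      ENNReal.ofReal (Real.sqrt (w' / w) ^ n * Real.exp (t / (2 * w'))) •
        μ.prod (Measure.pi fun _ : Fin n => gaussianReal 0 w') := by
  refine Measure.le_iff.2 fun A hA => ?_
  have hB : MeasurableSet {q : Design n J N × (Fin n → ℝ) | ∑ i, q.2 i ^ 2 ≤ t} :=
    measurableSet_le (by fun_prop) (by fun_prop)
  rw [Measure.restrict_apply hA, Measure.map_apply (measurable_knownDesign β) (hA.inter hB),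
    Measure.prod_apply ((measurable_knownDesign β) (hA.inter hB)), Measure.smul_apply,
    Measure.prod_apply hA, smul_eq_mul, ← lintegral_const_mul _ (measurable_measure_prodMk_left hA)]
  refine lintegral_mono fun X => ?_
  refine le_trans (le_of_eq ?_) (pi_gaussianReal_inter_ball_le (designMul X β) hw hw' t
    (measurable_prodMk_left hA))
  rw [← map_const_add_pi_gaussianReal (designMul X β), Measure.map_apply (by fun_prop)
    ((measurable_prodMk_left hA).inter (measurableSet_le (by fun_prop) (by fun_prop)))]
  rfl

theorem sum_sq_of_mem_blockEnsembleFinset_neg {J N K : ℕ} {u : ℝ} {β : Signal J N}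
    (hβ : β ∈ blockEnsembleFinset J N K u (-u)) : ∑ p, β p ^ 2 = (K * J : ℕ) * u ^ 2 := by
  obtain ⟨j, -, h⟩ := exists_count_of_mem_blockEnsembleFinset hβ
  rw [h (fun x => x ^ 2) (by norm_num)]
  ring

/-- The norm of the observations rarely exceeds its typical size. -/
theorem map_knownDesign_norm_gt_le {n J N : ℕ} (hn : 1 ≤ n) (τ w : ℝ≥0) (hw : w ≠ 0)
    (β : Signal J N) (hβ : 0 < τ * Real.toNNReal (∑ p, β p ^ 2)) :
    ((((gaussianDesign n J N 0 τ).prod (Measure.pi fun _ : Fin n => gaussianReal 0 w)).map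
        fun q => (q.1, designMul q.1 β + q.2)).restrict
          {q | ∑ i, q.2 i ^ 2 ≤ 80 * n * (τ * Real.toNNReal (∑ p, β p ^ 2) + w : ℝ≥0)}ᶜ) Set.univ ≤
      ENNReal.ofReal (1 / 20) := by
  set a := τ * Real.toNNReal (∑ p, β p ^ 2) with ha
  have hn' : (0 : ℝ) < n := by exact_mod_cast hn
  have ha' : (0 : ℝ) < a := hβ
  have hw' : (0 : ℝ) < w := by positivity
  have hB : MeasurableSet {q : Design n J N × (Fin n → ℝ) |
      ∑ i, q.2 i ^ 2 ≤ 80 * n * (a + w : ℝ≥0)} :=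
    measurableSet_le (by fun_prop) (by fun_prop)
  rw [Measure.restrict_apply_univ, Measure.map_apply (measurable_knownDesign β) hB.compl]
  set S : Set (Design n J N) := {X | 40 * n * a ≤ ∑ i, designMul X β i ^ 2} with hS
  set T : Set (Fin n → ℝ) := {e | 40 * n * w ≤ ∑ i, e i ^ 2} with hT
  have hsub : (fun q : Design n J N × (Fin n → ℝ) => (q.1, designMul q.1 β + q.2)) ⁻¹'
      {q | ∑ i, q.2 i ^ 2 ≤ 80 * n * (a + w : ℝ≥0)}ᶜ ⊆ S ×ˢ Set.univ ∪ Set.univ ×ˢ T := by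
    rintro ⟨X, e⟩ h
    by_contra hcon
    simp only [Set.mem_union, Set.mem_prod, Set.mem_univ, and_true, true_and, not_or, hS, hT,
      Set.mem_ofPred_eq, not_le] at hcon
    refine h ?_
    have h1 : ∑ i, (designMul X β i + e i) ^ 2 ≤
        ∑ i, (2 * designMul X β i ^ 2 + 2 * e i ^ 2) :=
      Finset.sum_le_sum fun i _ => by nlinarith [sq_nonneg (designMul X β i - e i)]
    rw [Finset.sum_add_distrib, ← Finset.mul_sum, ← Finset.mul_sum] at h1
    simp only [Set.mem_ofPred_eq, Pi.add_apply, NNReal.coe_add]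
    linarith [hcon.1, hcon.2]
  have hSμ : gaussianDesign n J N 0 τ S ≤ ENNReal.ofReal (1 / 40) := by
    have h1 : gaussianDesign n J N 0 τ S = ((gaussianDesign n J N 0 τ).map
        fun X => designMul X β) {x | 40 * n * a ≤ ∑ i, x i ^ 2} := by
      rw [Measure.map_apply (measurable_designMul β)
        (measurableSet_le (by fun_prop) (by fun_prop))]
      rfl
    rw [h1, map_designMul_gaussianDesign, zero_mul]
    refine (pi_gaussianReal_sum_sq_ge_le n _ (by positivity)).trans
      (ENNReal.ofReal_le_ofReal (le_of_eq ?_))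
    rw [← ha]
    field_simp
  have hTν : (Measure.pi fun _ : Fin n => gaussianReal 0 w) T ≤ ENNReal.ofReal (1 / 40) := by
    refine (pi_gaussianReal_sum_sq_ge_le n _ (by positivity)).trans
      (ENNReal.ofReal_le_ofReal (le_of_eq ?_))
    field_simp
  calc _ ≤ _ := measure_mono hsub
    _ ≤ _ := measure_union_le _ _
    _ ≤ ENNReal.ofReal (1 / 40) + ENNReal.ofReal (1 / 40) := by
        rw [Measure.prod_prod, Measure.prod_prod, measure_univ, measure_univ, mul_one, one_mul]
        gcongr
    _ = ENNReal.ofReal (1 / 20) := by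
        rw [← ENNReal.ofReal_add (by norm_num) (by norm_num)]; norm_num

theorem sqrt_one_add_div_pow_le {n : ℕ} (hn : 1 ≤ n) (x : ℝ) :
    Real.sqrt (1 + x / n) ^ n ≤ Real.exp (x / 2) := by
  have hn' : (0 : ℝ) < n := by exact_mod_cast hn
  have h1 : Real.sqrt (1 + x / n) ≤ Real.exp (x / (2 * n)) := by
    refine Real.sqrt_le_iff.2 ⟨Real.exp_nonneg _, ?_⟩
    rw [← Real.exp_nat_mul]
    have h2 : ((2 : ℕ) : ℝ) * (x / (2 * n)) = x / n := by push_cast; field_simp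
    rw [h2]
    linarith [Real.add_one_le_exp (x / n)]
  calc Real.sqrt (1 + x / n) ^ n ≤ Real.exp (x / (2 * n)) ^ n :=
        pow_le_pow_left₀ (Real.sqrt_nonneg _) h1 n
    _ = Real.exp (x / 2) := by
        rw [← Real.exp_nat_mul]; congr 1; field_simp

/-- The signal energy in `hu2` balances two demands. It is large enough that `4 C₀² (20 n σ²)` is at
most a tenth of it, so acceptable guesses are close in the sense of the counting bound. It is small
enough that the density bound `exp (x / 2 + 40 n)`, with `x` the energy divided by `σ²`, stays below
`exp (m / 140)`; the constant `c` is chosen for this. -/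
theorem noisyKnownDesign_necessary_samples {J N K n : ℕ} {σ : ℝ≥0} {C₀ c u : ℝ} (hJ : 1 ≤ J)
    (hK : 1 ≤ K) (hKN : K ≤ N) (hσ : 0 < σ) (hc : c = 1 / (140 * (400 * C₀ ^ 2 + 40)))
    (hu : 0 < u)
    (hu2 : (K * J : ℕ) * u ^ 2 = 800 * C₀ ^ 2 * c * blockSampleOrder J N K * σ ^ 2)
    (hn : (n : ℝ) ≤ c * blockSampleOrder J N K)
    {f : (Fin n → ℝ) → (Fin n → ℝ)} (hf : Measurable f)
    (κ : Kernel (Design n J N × (Fin n → ℝ)) (Signal J N)) [IsMarkovKernel κ]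
    {C : ℝ} (hC : 0 < C) (hCC₀ : C ≤ C₀) :
    1 / 10 ≤ noisyErrorKnownDesign (blockEnsemble J N K u (-u))
      (gaussianDesign n J N 0 (1 / (n : ℝ≥0))) (gaussianNoise n σ) f κ C := by
  have hF := nonempty_blockEnsembleFinset (J := J) hKN u (-u)
  rw [← coe_blockEnsembleFinset, noisyErrorKnownDesign_eq_lintegral _ _ _ hf]
  rcases Nat.eq_zero_or_pos n with rfl | hn0
  · rw [lintegral_error_zero_observations _ hF _ _
      (fun β q => (q.1, designMul q.1 β + q.2))]
    rw [one_div]; exact ENNReal.inv_le_one.2 (by norm_num)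
  set m := blockSampleOrder J N K with hm
  have hm0 : 1 ≤ m := one_le_blockSampleOrder hJ hK hKN
  have hn1 : (1 : ℝ) ≤ n := by exact_mod_cast hn0
  have hσ' : (0 : ℝ) < σ := hσ
  have hc0 : 0 < c := by rw [hc]; positivity
  have hcm : c * m * (400 * C₀ ^ 2 + 40) = m / 140 := by rw [hc]; field_simp
  have hw : σ ^ 2 ≠ 0 := by positivity
  set x := 800 * C₀ ^ 2 * c * m with hx
  set a : ℝ≥0 := 1 / (n : ℝ≥0) * Real.toNNReal ((K * J : ℕ) * u ^ 2) with ha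
  have hs0 : (0 : ℝ) < (K * J : ℕ) * u ^ 2 := by
    have : (0 : ℝ) < (K * J : ℕ) := by exact_mod_cast Nat.mul_pos hK hJ
    positivity
  have haR : (a : ℝ) = x * σ ^ 2 / n := by
    rw [ha, NNReal.coe_mul, Real.coe_toNNReal _ hs0.le, hu2]
    push_cast
    ring
  have ha0 : 0 < a := mul_pos (by positivity) (Real.toNNReal_pos.2 hs0)
  -- The variance of each observation, the same for every member of the ensemble because all have
  -- the same norm.
  set w' : ℝ≥0 := a + σ ^ 2 with hw'
  have hw'0 : w' ≠ 0 := by positivity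
  have hratio : ((w' : ℝ) / (σ ^ 2 : ℝ≥0)) = 1 + x / n := by
    rw [hw', NNReal.coe_add, haR]
    push_cast
    field_simp
    ring
  set M : ℝ := Real.sqrt (w' / (σ ^ 2 : ℝ≥0)) ^ n * Real.exp (80 * n * w' / (2 * w')) with hM
  have hM0 : 0 ≤ M := by positivity
  have hMle : M ≤ Real.exp (m / 140) := by
    have h1 : 80 * n * (w' : ℝ) / (2 * w') = 40 * n := by
      have : (w' : ℝ) ≠ 0 := by exact_mod_cast hw'0
      field_simp
      norm_num
    rw [hM, hratio, h1]
    calc _ ≤ Real.exp (x / 2) * Real.exp (40 * n) := by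
          gcongr; exact sqrt_one_add_div_pow_le hn0 x
      _ = Real.exp (x / 2 + 40 * n) := (Real.exp_add _ _).symm
      _ ≤ Real.exp (m / 140) := by
          refine Real.exp_le_exp.2 ?_
          rw [← hcm, hx]; linarith
  set F := blockEnsembleFinset J N K u (-u) with hFdef
  have hR : (0 : ℝ) < 20 * n * σ ^ 2 := by positivity
  have h := one_le_lintegral_error_add F hF (gaussianDesign n J N 0 (1 / (n : ℝ≥0)))
    (gaussianNoise n σ) (D := fun β q => (q.1, designMul q.1 β + q.2)) measurable_knownDesign
    (κ.comap (Prod.map id f) (measurable_id.prodMap hf)) hC hCC₀ (R := 20 * n * (σ : ℝ) ^ 2)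
    (ENNReal.ofReal M • (gaussianDesign n J N 0 (1 / (n : ℝ≥0))).prod
      (Measure.pi fun _ : Fin n => gaussianReal 0 w'))
    (fun β => (((gaussianDesign n J N 0 (1 / (n : ℝ≥0))).prod (gaussianNoise n σ)).map
      fun q => (q.1, designMul q.1 β + q.2)).restrict {q | ∑ i, q.2 i ^ 2 ≤ 80 * n * (w' : ℝ)}ᶜ)
    (r := ENNReal.ofReal (1 / 20)) (ℓ := ENNReal.ofReal (Real.exp (-m / 70) * F.card))
    (p := ENNReal.ofReal (1 / 20))
    (fun β _ => by
      have hB : MeasurableSet {q : Design n J N × (Fin n → ℝ) |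
        ∑ i, q.2 i ^ 2 ≤ 80 * n * (w' : ℝ)} := measurableSet_le (by fun_prop) (by fun_prop)
      refine (Measure.restrict_add_restrict_compl hB).symm.le.trans (add_le_add_left ?_ _)
      exact map_knownDesign_restrict_le _ β hw hw'0 _)
    (fun β hβ => by
      have h1 := map_knownDesign_norm_gt_le hn0 (1 / (n : ℝ≥0)) (σ ^ 2) hw β
      rw [sum_sq_of_mem_blockEnsembleFinset_neg hβ] at h1
      exact h1 ha0)
    (fun b => by
      rw [← ENNReal.ofReal_natCast]
      refine ENNReal.ofReal_le_ofReal (card_filter_close_blockEnsembleFinset_le hJ hK hKN hu ?_ b)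
      rw [hu2]
      have : (n : ℝ) * (C₀ ^ 2 * σ ^ 2) ≤ c * m * (C₀ ^ 2 * σ ^ 2) := by gcongr
      linarith)
    (by
      refine (pi_gaussianReal_sum_sq_ge_le n (σ ^ 2) hR).trans
        (ENNReal.ofReal_le_ofReal (le_of_eq ?_))
      push_cast
      field_simp)
  have hFc : (0 : ℝ) < F.card := by exact_mod_cast hF.card_pos
  have h1 : ENNReal.ofReal (Real.exp (-m / 70) * F.card) *
      (ENNReal.ofReal M • (gaussianDesign n J N 0 (1 / (n : ℝ≥0))).prod
        (Measure.pi fun _ : Fin n => gaussianReal 0 w')) Set.univ / (F.card : ℝ≥0∞) ≤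
      ENNReal.ofReal (1 / 20) := by
    rw [Measure.smul_apply, measure_univ, smul_eq_mul, mul_one, ← ENNReal.ofReal_mul (by positivity),
      ← ENNReal.ofReal_natCast F.card, ← ENNReal.ofReal_div_of_pos hFc]
    refine ENNReal.ofReal_le_ofReal ?_
    rw [mul_right_comm, mul_div_assoc, div_self hFc.ne', mul_one]
    -- From `1 ≤ n ≤ c m` and `c ≤ 1 / 5600`.
    have h2 : 5600 ≤ m := by
      have h3 : c * 5600 ≤ 1 := by
        rw [hc, div_mul_eq_mul_div, one_mul, div_le_one (by positivity)]
        nlinarith [sq_nonneg C₀]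
      have h4 : c * 5600 ≤ c * m := by linarith
      exact le_of_mul_le_mul_left h4 hc0
    calc Real.exp (-m / 70) * M ≤ Real.exp (-m / 70) * Real.exp (m / 140) := by gcongr
      _ = Real.exp (-(m / 140)) := by rw [← Real.exp_add]; congr 1; ring
      _ ≤ 1 / 20 := by
          rw [Real.exp_neg, one_div]
          exact inv_anti₀ (by norm_num) (by linarith [Real.add_one_le_exp (m / 140)])
  refine one_tenth_le_of_one_le_add (x := 1 / 20 + 1 / 20 + 1 / 20) (h.trans ?_) (by norm_num)
  rw [ENNReal.ofReal_add (by norm_num) (by norm_num), ENNReal.ofReal_add (by norm_num) (by norm_num)]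
  gcongr

/-! ### Concentration of `‖X β‖` for a fixed signal. -/

theorem measurable_sum_sq_designMul {n J N : ℕ} (β : Signal J N) :
    Measurable fun X : Design n J N => ∑ i, designMul X β i ^ 2 := by
  have := measurable_designMul (n := n) β
  fun_prop

theorem lintegral_exp_mul_sum_sq_designMul {n J N : ℕ} (hn : 1 ≤ n) {β : Signal J N}
    (hβ : 0 < ∑ p, β p ^ 2) {t : ℝ} (ht : 2 * t < 1) :
    ∫⁻ X, ENNReal.ofReal (Real.exp (t * n / (∑ p, β p ^ 2) * ∑ i, designMul X β i ^ 2))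
      ∂(gaussianDesign n J N 0 (1 / (n : ℝ≥0))) =
      ENNReal.ofReal (Real.sqrt (1 / (1 - 2 * t)) ^ n) := by
  set q := ∑ p, β p ^ 2 with hq
  have hn' : (0 : ℝ) < n := by exact_mod_cast hn
  set v : ℝ≥0 := 1 / (n : ℝ≥0) * Real.toNNReal q with hv
  have hvR : (v : ℝ) = q / n := by
    rw [hv, NNReal.coe_mul, Real.coe_toNNReal _ hβ.le]; push_cast; ring
  have hv0 : v ≠ 0 := by
    intro h
    have : (v : ℝ) = 0 := by rw [h]; rfl
    rw [hvR] at this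
    exact (div_pos hβ hn').ne' this
  have htv : 2 * (t * n / q) * v = 2 * t := by rw [hvR]; field_simp
  have h1 := lintegral_map (μ := gaussianDesign n J N 0 (1 / (n : ℝ≥0)))
    (f := fun x : Fin n → ℝ => ENNReal.ofReal (Real.exp (t * n / q * ∑ i, x i ^ 2)))
    (by fun_prop) (measurable_designMul β)
  rw [← h1, map_designMul_gaussianDesign, zero_mul, ← hq, ← hv]
  have h2 : ∀ x : Fin n → ℝ, ENNReal.ofReal (Real.exp (t * n / q * ∑ i, x i ^ 2)) =
      ∏ i, ENNReal.ofReal (Real.exp (t * n / q * x i ^ 2)) := fun x => by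
    rw [Finset.mul_sum, Real.exp_sum, ENNReal.ofReal_prod_of_nonneg fun i _ => Real.exp_nonneg _]
  simp only [h2]
  rw [lintegral_pi_prod (fun _ : Fin n => gaussianReal 0 v)
    (f := fun _ y => ENNReal.ofReal (Real.exp (t * n / q * y ^ 2))) (fun _ => by fun_prop),
    Finset.prod_const, Finset.card_univ, Fintype.card_fin,
    lintegral_exp_mul_sq_gaussianReal hv0 (by rw [htv]; exact ht), htv,
    ENNReal.ofReal_pow (Real.sqrt_nonneg _)]

/-- The sign of `t` is free, so one statement serves both tails. -/
theorem gaussianDesign_chernoff {n J N : ℕ} (hn : 1 ≤ n) {β : Signal J N}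
    (hβ : 0 < ∑ p, β p ^ 2) {t : ℝ} (ht : 2 * t < 1) {S : Set (Design n J N)} {a : ℝ}
    (hS : ∀ X ∈ S, a ≤ t * n / (∑ p, β p ^ 2) * ∑ i, designMul X β i ^ 2) :
    gaussianDesign n J N 0 (1 / (n : ℝ≥0)) S ≤
      ENNReal.ofReal (Real.sqrt (1 / (1 - 2 * t)) ^ n * Real.exp (-a)) := by
  have hm := measurable_sum_sq_designMul (n := n) β
  have h := meas_ge_le_lintegral_div (μ := gaussianDesign n J N 0 (1 / (n : ℝ≥0)))
    (f := fun X => ENNReal.ofReal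
      (Real.exp (t * n / (∑ p, β p ^ 2) * ∑ i, designMul X β i ^ 2)))
    (Measurable.aemeasurable (by fun_prop)) (ε := ENNReal.ofReal (Real.exp a))
    (by simpa using Real.exp_pos a) (by simp)
  rw [lintegral_exp_mul_sum_sq_designMul hn hβ ht, ← ENNReal.ofReal_div_of_pos (Real.exp_pos a)] at h
  rw [Real.exp_neg, ← div_eq_mul_inv]
  exact (measure_mono fun X hX =>
    ENNReal.ofReal_le_ofReal (Real.exp_le_exp.2 (hS X hX))).trans h

/-- A Gaussian design preserves the norm of a fixed signal up to a constant. -/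
theorem gaussianDesign_not_near_isometry_le {n J N : ℕ} (hn : 1 ≤ n) (β : Signal J N) :
    gaussianDesign n J N 0 (1 / (n : ℝ≥0))
      {X | ¬ ((∑ p, β p ^ 2) / 40 ≤ ∑ i, designMul X β i ^ 2 ∧
        ∑ i, designMul X β i ^ 2 ≤ 8 * ∑ p, β p ^ 2)} ≤
      ENNReal.ofReal (2 * Real.exp (-n)) := by
  have hn' : (0 : ℝ) < n := by exact_mod_cast hn
  rcases (Finset.sum_nonneg fun p _ => sq_nonneg (β p) : 0 ≤ ∑ p, β p ^ 2).eq_or_lt with h0 | hβ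
  · have hz : β = 0 := by
      funext p
      have := (Finset.sum_eq_zero_iff_of_nonneg fun p _ => sq_nonneg (β p)).1 h0.symm p
        (Finset.mem_univ p)
      exact pow_eq_zero_iff two_ne_zero |>.1 this
    simp [hz, designMul]
  set q := ∑ p, β p ^ 2 with hq
  have he := Real.exp_one_lt_d9
  -- With `t = -40` the bound is `(e / 9) ^ n`, at most `exp (-n)` because `e² ≤ 9`. With `t = 3 /
  -- 8` the upper tail gives `2 ^ n * exp (-3 n)`.
  have hlow := gaussianDesign_chernoff (n := n) hn hβ (t := -40) (by norm_num)
    (S := {X | ∑ i, designMul X β i ^ 2 < q / 40}) (a := -n) fun X hX => by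
      have hX' : ∑ i, designMul X β i ^ 2 < q / 40 := hX
      rw [← hq, div_mul_eq_mul_div, le_div_iff₀ hβ]
      nlinarith
  have hup := gaussianDesign_chernoff (n := n) hn hβ (t := 3 / 8) (by norm_num)
    (S := {X | 8 * q < ∑ i, designMul X β i ^ 2}) (a := 3 * n) fun X hX => by
      have hX' : 8 * q < ∑ i, designMul X β i ^ 2 := hX
      rw [← hq, div_mul_eq_mul_div, le_div_iff₀ hβ]
      nlinarith
  have h81 : Real.sqrt (1 / (1 - 2 * (-40))) = 1 / 9 := by
    rw [show (1 / (1 - 2 * (-40)) : ℝ) = (1 / 9) ^ 2 by norm_num]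
    exact Real.sqrt_sq (by norm_num)
  have h4 : Real.sqrt (1 / (1 - 2 * (3 / 8))) = 2 := by
    rw [show (1 / (1 - 2 * (3 / 8)) : ℝ) = 2 ^ 2 by norm_num]
    exact Real.sqrt_sq (by norm_num)
  have hlow' : Real.sqrt (1 / (1 - 2 * (-40))) ^ n * Real.exp (-(-(n : ℝ))) ≤ Real.exp (-n) := by
    have h1 : (1 / 9 : ℝ) ≤ Real.exp (-2) := by
      rw [Real.exp_neg, one_div]
      refine inv_anti₀ (Real.exp_pos _) ?_
      rw [show (2 : ℝ) = 1 + 1 by norm_num, Real.exp_add]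
      nlinarith [Real.exp_pos 1]
    calc _ ≤ Real.exp (-2) ^ n * Real.exp (-(-(n : ℝ))) := by rw [h81]; gcongr
      _ = Real.exp (-n) := by rw [← Real.exp_nat_mul, ← Real.exp_add]; congr 1; ring
  have hup' : Real.sqrt (1 / (1 - 2 * (3 / 8))) ^ n * Real.exp (-(3 * (n : ℝ))) ≤
      Real.exp (-n) := by
    have h1 : (2 : ℝ) ≤ Real.exp 2 := by linarith [Real.add_one_le_exp (2 : ℝ)]
    calc _ ≤ Real.exp 2 ^ n * Real.exp (-(3 * (n : ℝ))) := by rw [h4]; gcongr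
      _ = Real.exp (-n) := by rw [← Real.exp_nat_mul, ← Real.exp_add]; congr 1; ring
  calc _ ≤ gaussianDesign n J N 0 (1 / (n : ℝ≥0)) ({X | ∑ i, designMul X β i ^ 2 < q / 40} ∪
        {X | 8 * q < ∑ i, designMul X β i ^ 2}) := measure_mono fun X hX => by
          simp only [Set.mem_ofPred_eq, not_and_or, not_le] at hX
          exact hX
    _ ≤ _ := measure_union_le _ _
    _ ≤ ENNReal.ofReal (Real.exp (-n)) + ENNReal.ofReal (Real.exp (-n)) :=
        add_le_add (hlow.trans (ENNReal.ofReal_le_ofReal hlow'))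
          (hup.trans (ENNReal.ofReal_le_ofReal hup'))
    _ = _ := by rw [← ENNReal.ofReal_add (by positivity) (by positivity), two_mul]

/-! ### Counting lattice points and supports. -/

/-- Integer vectors of `ℓ¹`-norm at most `B` supported on the columns in `L`. -/
def latticeOn (J : ℕ) {N : ℕ} (B : ℕ) (L : Finset (Fin N)) : Finset (Fin J × Fin N → ℤ) :=
  (Fintype.piFinset fun p : Fin J × Fin N =>
    if p.2 ∈ L then Finset.Icc (-(B : ℤ)) B else {0}).filter fun k => ∑ p, (k p).natAbs ≤ B

theorem mem_latticeOn {J N B : ℕ} {L : Finset (Fin N)} {k : Fin J × Fin N → ℤ}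
    (hk : ∀ p : Fin J × Fin N, p.2 ∉ L → k p = 0) (hB : ∑ p, (k p).natAbs ≤ B) :
    k ∈ latticeOn J B L := by
  rw [latticeOn, Finset.mem_filter, Fintype.mem_piFinset]
  refine ⟨fun p => ?_, hB⟩
  split_ifs with hp
  · have h1 : (k p).natAbs ≤ ∑ p, (k p).natAbs :=
      Finset.single_le_sum (f := fun p => (k p).natAbs) (fun _ _ => Nat.zero_le _)
        (Finset.mem_univ p)
    rw [Finset.mem_Icc]
    omega
  · simpa using hk p hp

theorem sum_Icc_half_pow_natAbs_le (B : ℕ) :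
    ∑ k ∈ Finset.Icc (-(B : ℤ)) B, (1 / 2 : ℝ) ^ k.natAbs ≤ 3 := by
  have h : ∑ k ∈ Finset.Icc (-(B : ℤ)) B, (1 / 2 : ℝ) ^ k.natAbs = 3 - 2 * (1 / 2) ^ B := by
    induction B with
    | zero => norm_num
    | succ B ih =>
      have h1 : Finset.Icc (-((B + 1 : ℕ) : ℤ)) (B + 1 : ℕ) =
          insert (-((B + 1 : ℕ) : ℤ)) (insert ((B + 1 : ℕ) : ℤ) (Finset.Icc (-(B : ℤ)) B)) := by
        ext k
        simp only [Finset.mem_insert, Finset.mem_Icc]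
        omega
      have h2 : (-((B + 1 : ℕ) : ℤ)).natAbs = B + 1 := by omega
      have h3 : ((B + 1 : ℕ) : ℤ).natAbs = B + 1 := by omega
      rw [h1, Finset.sum_insert (by simp only [Finset.mem_insert, Finset.mem_Icc]; omega),
        Finset.sum_insert (by simp only [Finset.mem_Icc]; omega), ih, h2, h3, pow_succ]
      ring
  rw [h]
  have : (0 : ℝ) < (1 / 2) ^ B := by positivity
  linarith

/-- Each point has weight `2 ^ (B - ‖k‖₁) ≥ 1`, and the sum of the weights factorises over the
entries into geometric series of sum at most 3. -/
theorem card_latticeOn_le (J : ℕ) {N : ℕ} (B : ℕ) (L : Finset (Fin N)) :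
    ((latticeOn J B L).card : ℝ) ≤ 2 ^ B * 3 ^ (L.card * J) := by
  set P := Fintype.piFinset fun p : Fin J × Fin N =>
    if p.2 ∈ L then Finset.Icc (-(B : ℤ)) B else {0} with hP
  have h1 : ∀ k ∈ latticeOn J B L, (1 : ℝ) ≤ 2 ^ B * ∏ p, (1 / 2 : ℝ) ^ (k p).natAbs := by
    intro k hk
    rw [Finset.prod_pow_eq_pow_sum, one_div, inv_pow, ← div_eq_mul_inv,
      one_le_div (by positivity)]
    exact pow_le_pow_right₀ (by norm_num) (Finset.mem_filter.1 hk).2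
  calc ((latticeOn J B L).card : ℝ)
      ≤ ∑ k ∈ latticeOn J B L, 2 ^ B * ∏ p, (1 / 2 : ℝ) ^ (k p).natAbs := by
        simpa using Finset.sum_le_sum h1
    _ ≤ ∑ k ∈ P, 2 ^ B * ∏ p, (1 / 2 : ℝ) ^ (k p).natAbs :=
        Finset.sum_le_sum_of_subset_of_nonneg (Finset.filter_subset _ _) fun k _ _ => by positivity
    _ = 2 ^ B * ∏ p : Fin J × Fin N, ∑ k ∈ (if p.2 ∈ L then Finset.Icc (-(B : ℤ)) B else {0}),
          (1 / 2 : ℝ) ^ k.natAbs := by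
        rw [← Finset.mul_sum, hP,
          ← Finset.prod_univ_sum _ fun _ (k : ℤ) => (1 / 2 : ℝ) ^ k.natAbs]
    _ ≤ 2 ^ B * ∏ p : Fin J × Fin N, (if p.2 ∈ L then 3 else 1) := by
        refine mul_le_mul_of_nonneg_left (Finset.prod_le_prod
          (fun p _ => Finset.sum_nonneg fun _ _ => by positivity) fun p _ => ?_) (by positivity)
        split_ifs
        · exact sum_Icc_half_pow_natAbs_le B
        · simp
    _ = 2 ^ B * 3 ^ (L.card * J) := by
        rw [Finset.prod_ite, Finset.prod_const_one, mul_one, Finset.prod_const,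
          card_filter_snd_mem]

/-- Give `L` the weight `(N / K) ^ (2 K - |L|)`, at least 1 on the sets counted. The sum over all
`L` is `(N / K) ^ (2 K) * (1 + K / N) ^ N`, and the last factor is at most `exp K`. -/
theorem card_filter_card_le {N K : ℕ} (hK : 1 ≤ K) (hKN : K ≤ N) :
    (((Finset.univ : Finset (Finset (Fin N))).filter fun L => L.card ≤ 2 * K).card : ℝ) ≤
      Real.exp (2 * K * Real.log (N / K) + K) := by
  set ℓ := Real.log ((N : ℝ) / K) with hℓ
  have hK' : (1 : ℝ) ≤ K := by exact_mod_cast hK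
  have hN : (0 : ℝ) < N := by linarith [(by exact_mod_cast hKN : (K : ℝ) ≤ N)]
  have hNK : (1 : ℝ) ≤ (N : ℝ) / K := by
    rw [le_div_iff₀ (by linarith), one_mul]; exact_mod_cast hKN
  have hℓ0 : 0 ≤ ℓ := Real.log_nonneg hNK
  have h5 : Real.exp (-ℓ) * N = K := by
    rw [Real.exp_neg, hℓ, Real.exp_log (by linarith)]; field_simp
  calc (((Finset.univ : Finset (Finset (Fin N))).filter fun L => L.card ≤ 2 * K).card : ℝ)
      ≤ ∑ L ∈ (Finset.univ : Finset (Finset (Fin N))).filter fun L => L.card ≤ 2 * K,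
          Real.exp (2 * K * ℓ) * ∏ _i ∈ L, Real.exp (-ℓ) := by
        have h1 : ∀ L ∈ (Finset.univ : Finset (Finset (Fin N))).filter fun L => L.card ≤ 2 * K,
            (1 : ℝ) ≤ Real.exp (2 * K * ℓ) * ∏ _i ∈ L, Real.exp (-ℓ) := by
          intro L hL
          have hL' : (L.card : ℝ) ≤ 2 * K := by exact_mod_cast (Finset.mem_filter.1 hL).2
          rw [Finset.prod_const, ← Real.exp_nat_mul, ← Real.exp_add, Real.one_le_exp_iff]
          nlinarith
        simpa using Finset.sum_le_sum h1
    _ ≤ ∑ L ∈ (Finset.univ : Finset (Fin N)).powerset,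
          Real.exp (2 * K * ℓ) * ∏ _i ∈ L, Real.exp (-ℓ) :=
        Finset.sum_le_sum_of_subset_of_nonneg
          (fun L _ => Finset.mem_powerset.2 (Finset.subset_univ _)) fun _ _ _ => by positivity
    _ = Real.exp (2 * K * ℓ) * (1 + Real.exp (-ℓ)) ^ N := by
        rw [← Finset.mul_sum, ← Finset.prod_one_add]; simp
    _ ≤ Real.exp (2 * K * ℓ) * Real.exp (Real.exp (-ℓ)) ^ N := by
        gcongr
        linarith [Real.add_one_le_exp (Real.exp (-ℓ))]
    _ = Real.exp (2 * K * ℓ + K) := by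
        rw [← Real.exp_nat_mul, ← Real.exp_add, mul_comm (N : ℝ), h5]

/-! ### From lattice points to all sparse signals. -/

theorem l2norm_eq_norm {ι : Type*} [Fintype ι] (x : ι → ℝ) :
    l2norm x = ‖(WithLp.toLp 2 x : EuclideanSpace ℝ ι)‖ := by
  rw [EuclideanSpace.norm_eq, l2norm]; simp

theorem l2norm_sq {ι : Type*} [Fintype ι] (x : ι → ℝ) : l2norm x ^ 2 = ∑ i, x i ^ 2 :=
  Real.sq_sqrt (Finset.sum_nonneg fun _ _ => sq_nonneg _)

theorem l2norm_nonneg {ι : Type*} [Fintype ι] (x : ι → ℝ) : 0 ≤ l2norm x := Real.sqrt_nonneg _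

theorem l2norm_add_le {ι : Type*} [Fintype ι] (x y : ι → ℝ) :
    l2norm (x + y) ≤ l2norm x + l2norm y := by
  simp only [l2norm_eq_norm, WithLp.toLp_add]; exact norm_add_le _ _

theorem l2norm_smul {ι : Type*} [Fintype ι] (c : ℝ) (x : ι → ℝ) :
    l2norm (c • x) = |c| * l2norm x := by
  simp only [l2norm_eq_norm, WithLp.toLp_smul, norm_smul, Real.norm_eq_abs]

theorem l2norm_neg {ι : Type*} [Fintype ι] (x : ι → ℝ) : l2norm (-x) = l2norm x := by
  simp [l2norm]

theorem l2norm_eq_zero {ι : Type*} [Fintype ι] {x : ι → ℝ} (h : l2norm x = 0) : x = 0 := by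
  rw [l2norm_eq_norm, norm_eq_zero] at h
  exact (WithLp.toLp_eq_zero 2).1 h

theorem designMul_add {n J N : ℕ} (X : Design n J N) (β γ : Signal J N) :
    designMul X (β + γ) = designMul X β + designMul X γ := by
  ext i; simp [designMul, mul_add, Finset.sum_add_distrib]

theorem designMul_smul {n J N : ℕ} (X : Design n J N) (c : ℝ) (β : Signal J N) :
    designMul X (c • β) = c • designMul X β := by
  ext i; simp [designMul, Finset.mul_sum, mul_left_comm]

theorem designMul_sub {n J N : ℕ} (X : Design n J N) (β γ : Signal J N) :
    designMul X (β - γ) = designMul X β - designMul X γ := by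
  ext i; simp [designMul, mul_sub, Finset.sum_sub_distrib]

theorem sum_sq_designMul_le {n J N : ℕ} (X : Design n J N) (β : Signal J N) :
    ∑ i, designMul X β i ^ 2 ≤ (∑ i, ∑ p, X i p ^ 2) * ∑ p, β p ^ 2 := by
  rw [Finset.sum_mul]
  exact Finset.sum_le_sum fun i _ => Finset.sum_mul_sq_le_sq_mul_sq _ _ _

/-- A design nearly isometric on a fine lattice is bounded below on sparse signals. -/
theorem l2norm_le_of_near_isometry_on_lattice {n J N s : ℕ} (hs : 1 ≤ s) (X : Design n J N)
    {L : Finset (Fin N)} (hL : L.card * J ≤ 2 * s)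
    (hX : ∀ k ∈ latticeOn J (80000 * s) L,
      (∑ p, (k p : ℝ) ^ 2) / 40 ≤ ∑ i, designMul X (fun p => (k p : ℝ)) i ^ 2 ∧
        ∑ i, designMul X (fun p => (k p : ℝ)) i ^ 2 ≤ 8 * ∑ p, (k p : ℝ) ^ 2)
    {h : Signal J N} (hh : ∀ p : Fin J × Fin N, p.2 ∉ L → h p = 0) :
    l2norm h ≤ 20 * l2norm (designMul X h) := by
  have hs' : (1 : ℝ) ≤ s := by exact_mod_cast hs
  -- At most `2 s` entries are rounded, each by less than the mesh `η`, so the rounding error has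
  -- norm at most `1 / 100`.
  set η : ℝ := 1 / (100 * Real.sqrt (2 * s)) with hη
  have hsq : Real.sqrt (2 * s) ^ 2 = 2 * s := Real.sq_sqrt (by positivity)
  have hsq0 : 0 < Real.sqrt (2 * s) := Real.sqrt_pos.2 (by linarith)
  have hη0 : 0 < η := by positivity
  have hη2 : η ^ 2 * (2 * s) = 1 / 100 ^ 2 := by
    rw [hη, div_pow, mul_pow, hsq]; field_simp
  let W : Set (Signal J N) := {h | (∀ p : Fin J × Fin N, p.2 ∉ L → h p = 0) ∧ l2norm h ≤ 1}
  have hround : ∀ h ∈ W, ∃ k ∈ latticeOn J (80000 * s) L,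
      l2norm (h - η • fun p => (k p : ℝ)) ≤ 1 / 100 := by
    intro h hh
    set k : Fin J × Fin N → ℤ := fun p => ⌊h p / η⌋ with hk
    have hk0 : ∀ p : Fin J × Fin N, p.2 ∉ L → k p = 0 := fun p hp => by simp [hk, hh.1 p hp]
    have herr : l2norm (h - η • fun p => (k p : ℝ)) ≤ 1 / 100 := by
      refine Real.sqrt_le_iff.2 ⟨by norm_num, ?_⟩
      have h1 : ∀ p : Fin J × Fin N, (h - η • fun p => (k p : ℝ)) p ^ 2 ≤
          if p.2 ∈ L then η ^ 2 else 0 := by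
        intro p
        simp only [Pi.sub_apply, Pi.smul_apply, smul_eq_mul]
        split_ifs with hp
        · have h2 := Int.floor_le (h p / η)
          have h3 := Int.lt_floor_add_one (h p / η)
          rw [le_div_iff₀ hη0] at h2
          rw [div_lt_iff₀ hη0] at h3
          simp only [hk]
          refine pow_le_pow_left₀ ?_ ?_ 2 <;> linarith
        · rw [hh.1 p hp, hk0 p hp]; simp
      refine (Finset.sum_le_sum fun p _ => h1 p).trans ?_
      rw [Finset.sum_ite, Finset.sum_const_zero, add_zero, Finset.sum_const, card_filter_snd_mem,
        nsmul_eq_mul]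
      have h4 : ((L.card * J : ℕ) : ℝ) ≤ 2 * s := by exact_mod_cast hL
      nlinarith [sq_nonneg η]
    -- The rounded vector has norm at most 2, so `∑ k² ≤ 4 / η² = 80000 s`. This bounds the
    -- `ℓ¹`-norm too, since `|k| ≤ k²` for integers.
    refine ⟨k, mem_latticeOn hk0 ?_, herr⟩
    have h5 : l2norm (η • fun p => (k p : ℝ)) ≤ 2 := by
      have h6 : (η • fun p => (k p : ℝ)) = h + -(h - η • fun p => (k p : ℝ)) := by abel
      rw [h6]
      refine (l2norm_add_le _ _).trans ?_
      rw [l2norm_neg]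
      linarith [hh.2]
    have h7 : η ^ 2 * ∑ p, (k p : ℝ) ^ 2 ≤ 4 := by
      have h8 := l2norm_sq (η • fun p => (k p : ℝ))
      simp only [Pi.smul_apply, smul_eq_mul, mul_pow, ← Finset.mul_sum] at h8
      rw [← h8]
      nlinarith [l2norm_nonneg (η • fun p => (k p : ℝ))]
    have h9 : ∑ p, (k p : ℝ) ^ 2 ≤ 80000 * s := by
      refine le_of_mul_le_mul_left (h7.trans (le_of_eq ?_)) (pow_pos hη0 2)
      linarith
    have h10 : ((∑ p, (k p).natAbs : ℕ) : ℝ) ≤ ∑ p, (k p : ℝ) ^ 2 := by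
      push_cast
      refine Finset.sum_le_sum fun p _ => ?_
      have h11 : ((k p).natAbs : ℤ) ≤ (k p) ^ 2 := by
        rw [← Int.natAbs_sq, sq]
        exact_mod_cast Nat.le_mul_self _
      calc ((k p).natAbs : ℝ) = (((k p).natAbs : ℤ) : ℝ) := (Int.cast_natCast _).symm
        _ ≤ (((k p) ^ 2 : ℤ) : ℝ) := by exact_mod_cast h11
        _ = _ := by push_cast; rfl
    exact_mod_cast h10.trans h9
  have hlat : ∀ k ∈ latticeOn J (80000 * s) L,
      l2norm (η • fun p => (k p : ℝ)) ≤ 7 * l2norm (designMul X (η • fun p => (k p : ℝ))) ∧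
      l2norm (designMul X (η • fun p => (k p : ℝ))) ≤
        3 * l2norm (η • fun p => (k p : ℝ)) := by
    intro k hk
    obtain ⟨h1, h2⟩ := hX k hk
    rw [← l2norm_sq (designMul X fun p => (k p : ℝ)), ← l2norm_sq fun p => (k p : ℝ)] at h1 h2
    have n1 := l2norm_nonneg (designMul X fun p => (k p : ℝ))
    have n2 := l2norm_nonneg fun p => (k p : ℝ)
    have h3 : l2norm (fun p => (k p : ℝ)) ≤ 7 * l2norm (designMul X fun p => (k p : ℝ)) :=
      abs_le_of_sq_le_sq' (by nlinarith) (by positivity) |>.2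
    have h4 : l2norm (designMul X fun p => (k p : ℝ)) ≤ 3 * l2norm (fun p => (k p : ℝ)) :=
      abs_le_of_sq_le_sq' (by nlinarith) (by positivity) |>.2
    rw [designMul_smul, l2norm_smul, l2norm_smul]
    have := abs_nonneg η
    constructor <;> nlinarith
  set T : Set ℝ := (fun h => l2norm (designMul X h)) '' W with hT
  have hbdd : BddAbove T := by
    refine ⟨Real.sqrt (∑ i, ∑ p, X i p ^ 2), ?_⟩
    rintro _ ⟨h, hh, rfl⟩
    refine Real.sqrt_le_sqrt ((sum_sq_designMul_le X h).trans ?_)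
    have h1 : ∑ p, h p ^ 2 ≤ 1 := by
      rw [← l2norm_sq]; exact pow_le_one₀ (l2norm_nonneg h) hh.2
    exact mul_le_of_le_one_right
      (Finset.sum_nonneg fun _ _ => Finset.sum_nonneg fun _ _ => sq_nonneg _) h1
  -- The norm of `X` on the unit ball of the support. Rounding bounds `S` by a lattice term plus `S
  -- / 100`, which can be absorbed because `S` is finite.
  set S := sSup T with hS
  have hle : ∀ h ∈ W, l2norm (designMul X h) ≤ S := fun h hh => le_csSup hbdd ⟨h, hh, rfl⟩
  have hsmall : ∀ g : Signal J N, (∀ p : Fin J × Fin N, p.2 ∉ L → g p = 0) →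
      l2norm g ≤ 1 / 100 → l2norm (designMul X g) ≤ S / 100 := by
    intro g hg hg'
    have h1 := hle ((100 : ℝ) • g) ⟨fun p hp => by simp [hg p hp], by
      rw [l2norm_smul, abs_of_pos (by norm_num)]; linarith⟩
    rw [designMul_smul, l2norm_smul, abs_of_pos (by norm_num)] at h1
    linarith
  have hsupp : ∀ h ∈ W, ∀ k ∈ latticeOn J (80000 * s) L, ∀ p : Fin J × Fin N, p.2 ∉ L →
      (h - η • fun p => (k p : ℝ)) p = 0 := by
    intro h hh k hk p hp
    have hkp : k p = 0 := by
      have := Fintype.mem_piFinset.1 (Finset.mem_filter.1 hk).1 p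
      simpa [hp] using this
    simp [hh.1 p hp, hkp]
  have hS7 : S ≤ 7 := by
    have h1 : S ≤ 3 * (1 + 1 / 100) + S / 100 := by
      refine csSup_le ⟨_, 0, ⟨fun _ _ => rfl, by simp [l2norm]⟩, rfl⟩ ?_
      rintro _ ⟨h, hh, rfl⟩
      obtain ⟨k, hk, hke⟩ := hround h hh
      have h2 := hsmall _ (hsupp h hh k hk) hke
      have h3 := (hlat k hk).2
      have h4 : l2norm (η • fun p => (k p : ℝ)) ≤ 1 + 1 / 100 := by
        have h6 : (η • fun p => (k p : ℝ)) = h + -(h - η • fun p => (k p : ℝ)) := by abel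
        rw [h6]
        refine (l2norm_add_le _ _).trans ?_
        rw [l2norm_neg]
        linarith [hh.2]
      have h5 : designMul X h = designMul X (η • fun p => (k p : ℝ)) +
          designMul X (h - η • fun p => (k p : ℝ)) := by rw [← designMul_add]; congr 1; abel
      simp only
      rw [h5]
      refine (l2norm_add_le _ _).trans ?_
      linarith
    linarith
  -- Here `99 / 100 ≤ 7 (‖X h‖ + 7 / 100)`, so `‖X h‖ ≥ 1 / 14`.
  have hunit : ∀ h ∈ W, l2norm h = 1 → 1 ≤ 20 * l2norm (designMul X h) := by
    intro h hh hh1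
    obtain ⟨k, hk, hke⟩ := hround h hh
    have h2 := hsmall _ (hsupp h hh k hk) hke
    have h3 := (hlat k hk).1
    have h4 : 1 ≤ l2norm (η • fun p => (k p : ℝ)) + 1 / 100 := by
      have h6 : h = (η • fun p => (k p : ℝ)) + (h - η • fun p => (k p : ℝ)) := by abel
      have h7 := l2norm_add_le (η • fun p => (k p : ℝ)) (h - η • fun p => (k p : ℝ))
      rw [← h6, hh1] at h7
      linarith
    have h5 : designMul X (η • fun p => (k p : ℝ)) = designMul X h +
        -designMul X (h - η • fun p => (k p : ℝ)) := by rw [designMul_sub]; abel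
    have h8 := l2norm_add_le (designMul X h) (-designMul X (h - η • fun p => (k p : ℝ)))
    rw [← h5, l2norm_neg] at h8
    linarith
  rcases (l2norm_nonneg h).eq_or_lt with h0 | h0
  · rw [← h0]; exact mul_nonneg (by norm_num) (l2norm_nonneg _)
  · have hu : l2norm ((l2norm h)⁻¹ • h) = 1 := by
      rw [l2norm_smul, abs_of_pos (inv_pos.2 h0), inv_mul_cancel₀ h0.ne']
    have h1 := hunit ((l2norm h)⁻¹ • h) ⟨fun p hp => by simp [hh p hp], hu.le⟩ hu
    rw [designMul_smul, l2norm_smul, abs_of_pos (inv_pos.2 h0)] at h1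
    have h2 : l2norm h * 1 ≤ l2norm h * (20 * ((l2norm h)⁻¹ * l2norm (designMul X h))) := by
      gcongr
    calc l2norm h ≤ l2norm h * (20 * ((l2norm h)⁻¹ * l2norm (designMul X h))) := by linarith
      _ = 20 * l2norm (designMul X h) := by field_simp

/-- A Gaussian design with enough samples is bounded below on all `2 K`-block-sparse signals, up to an
event of exponentially small probability. -/
theorem gaussianDesign_not_bounded_below_le {n J N K : ℕ} (hJ : 1 ≤ J) (hK : 1 ≤ K) (hKN : K ≤ N)
    (hn : 160012 * blockSampleOrder J N K ≤ n) :
    gaussianDesign n J N 0 (1 / (n : ℝ≥0))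
      {X | ¬ ∀ (L : Finset (Fin N)) (h : Signal J N), L.card ≤ 2 * K →
        (∀ p : Fin J × Fin N, p.2 ∉ L → h p = 0) → l2norm h ≤ 20 * l2norm (designMul X h)} ≤
      ENNReal.ofReal (Real.exp (-(n : ℝ) / 160012)) := by
  set m := blockSampleOrder J N K with hm
  have hm1 : 1 ≤ m := one_le_blockSampleOrder hJ hK hKN
  have hnR : (0 : ℝ) < n := by linarith
  have hn1 : 1 ≤ n := by exact_mod_cast hnR
  set 𝓛 := (Finset.univ : Finset (Finset (Fin N))).filter fun L => L.card ≤ 2 * K with h𝓛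
  set bad : (Fin J × Fin N → ℤ) → Set (Design n J N) := fun k =>
    {X | ¬ ((∑ p, (k p : ℝ) ^ 2) / 40 ≤ ∑ i, designMul X (fun p => (k p : ℝ)) i ^ 2 ∧
        ∑ i, designMul X (fun p => (k p : ℝ)) i ^ 2 ≤ 8 * ∑ p, (k p : ℝ) ^ 2)} with hbad
  set s := K * J with hs
  have hs1 : 1 ≤ s := Nat.mul_pos hK hJ
  have hsub : {X | ¬ ∀ (L : Finset (Fin N)) (h : Signal J N), L.card ≤ 2 * K →
        (∀ p : Fin J × Fin N, p.2 ∉ L → h p = 0) → l2norm h ≤ 20 * l2norm (designMul X h)} ⊆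
      ⋃ L ∈ 𝓛, ⋃ k ∈ latticeOn J (80000 * s) L, bad k := by
    intro X hX
    by_contra hcon
    simp only [Set.mem_iUnion, not_exists] at hcon
    refine hX fun L h hL hh => l2norm_le_of_near_isometry_on_lattice hs1 X (s := s) (L := L) ?_
      (fun k hk => ?_) hh
    · rw [hs, ← mul_assoc]; exact Nat.mul_le_mul_right J hL
    · exact not_not.1 (hcon L (by simp [h𝓛, hL]) k hk)
  have hcount : ∀ L ∈ 𝓛, ((latticeOn J (80000 * s) L).card : ℝ) ≤
      Real.exp (80000 * s + 4 * s) := by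
    intro L hL
    have hL' : L.card * J ≤ 2 * s := by
      rw [hs, ← mul_assoc]; exact Nat.mul_le_mul_right J (Finset.mem_filter.1 hL).2
    have h2 : (2 : ℝ) ≤ Real.exp 1 := by linarith [Real.add_one_le_exp (1 : ℝ)]
    have h3 : (3 : ℝ) ≤ Real.exp 2 := by linarith [Real.add_one_le_exp (2 : ℝ)]
    calc ((latticeOn J (80000 * s) L).card : ℝ) ≤ 2 ^ (80000 * s) * 3 ^ (L.card * J) :=
          card_latticeOn_le J _ L
      _ ≤ 2 ^ (80000 * s) * 3 ^ (2 * s) := by gcongr; norm_num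
      _ ≤ Real.exp 1 ^ (80000 * s) * Real.exp 2 ^ (2 * s) := by gcongr
      _ = Real.exp (80000 * s + 4 * s) := by
          rw [← Real.exp_nat_mul, ← Real.exp_nat_mul, ← Real.exp_add]
          push_cast; ring_nf
  have hprob : ∀ k, gaussianDesign n J N 0 (1 / (n : ℝ≥0)) (bad k) ≤
      ENNReal.ofReal (2 * Real.exp (-n)) := fun k =>
    gaussianDesign_not_near_isometry_le hn1 fun p => (k p : ℝ)
  calc _ ≤ gaussianDesign n J N 0 (1 / (n : ℝ≥0))
        (⋃ L ∈ 𝓛, ⋃ k ∈ latticeOn J (80000 * s) L, bad k) := measure_mono hsub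
    _ ≤ ∑ L ∈ 𝓛, ∑ k ∈ latticeOn J (80000 * s) L,
          gaussianDesign n J N 0 (1 / (n : ℝ≥0)) (bad k) :=
        (measure_biUnion_finset_le _ _).trans
          (Finset.sum_le_sum fun L _ => measure_biUnion_finset_le _ _)
    _ ≤ ∑ L ∈ 𝓛, ∑ k ∈ latticeOn J (80000 * s) L, ENNReal.ofReal (2 * Real.exp (-n)) :=
        Finset.sum_le_sum fun L _ => Finset.sum_le_sum fun k _ => hprob k
    _ = ENNReal.ofReal (∑ L ∈ 𝓛, ((latticeOn J (80000 * s) L).card : ℝ) *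
          (2 * Real.exp (-n))) := by
        rw [ENNReal.ofReal_sum_of_nonneg fun _ _ => by positivity]
        refine Finset.sum_congr rfl fun L _ => ?_
        rw [Finset.sum_const, nsmul_eq_mul, ENNReal.ofReal_mul (Nat.cast_nonneg _),
          ENNReal.ofReal_natCast]
    _ ≤ _ := by
        refine ENNReal.ofReal_le_ofReal ?_
        have hcard := card_filter_card_le hK hKN
        have hKs : (K : ℝ) ≤ s := by exact_mod_cast Nat.le_mul_of_pos_right K hJ
        have hms : m = s + K * Real.log (N / K) := by
          rw [hm, blockSampleOrder, hs]; push_cast; rfl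
        have hℓ : 0 ≤ K * Real.log ((N : ℝ) / K) := by
          have := le_blockSampleOrder (J := J) hK hKN
          rw [← hm, hms] at this
          linarith
        have h2 : (2 : ℝ) ≤ Real.exp m := by linarith [Real.add_one_le_exp m]
        calc ∑ L ∈ 𝓛, ((latticeOn J (80000 * s) L).card : ℝ) * (2 * Real.exp (-n))
            ≤ ∑ L ∈ 𝓛, Real.exp (80000 * s + 4 * s) * (Real.exp m * Real.exp (-n)) :=
              Finset.sum_le_sum fun L hL => by
                gcongr
                exact hcount L hL
          _ = (𝓛.card : ℝ) * (Real.exp (80000 * s + 4 * s) * (Real.exp m * Real.exp (-n))) := by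
              rw [Finset.sum_const, nsmul_eq_mul]
          _ ≤ Real.exp (2 * K * Real.log (N / K) + K) *
              (Real.exp (80000 * s + 4 * s) * (Real.exp m * Real.exp (-n))) := by gcongr
          _ = Real.exp (2 * K * Real.log (N / K) + K + (80000 * s + 4 * s + (m + -n))) := by
              rw [← Real.exp_add, ← Real.exp_add, ← Real.exp_add]
          _ ≤ Real.exp (-(n : ℝ) / 160012) := by
              refine Real.exp_le_exp.2 ?_
              -- The entropy of supports and lattice points, with the factor 2 absorbed in `exp m`,
              -- costs at most `80006 m`. This is at most `n / 2` because `160012 = 2 * 80006`.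
              have h4 : 2 * K * Real.log (N / K) + K + (80000 * s + 4 * s + (m + -n)) ≤
                  80006 * m - n := by
                rw [hms]; nlinarith
              linarith

/-! ### The least squares decoder. -/

/-- The least squares solution of a noisy consistent linear system fits the clean data up to the norm
of the noise. -/
theorem l2norm_leastSquares_sub_le {m ι : Type*} [Fintype m] [Fintype ι] [DecidableEq ι]
    (A : Matrix m ι ℝ) (hA : Function.Injective A.mulVec) (w : ι → ℝ) (e : m → ℝ) :
    l2norm (A.mulVec ((A.transpose * A)⁻¹.mulVec (A.transpose.mulVec (A.mulVec w + e)))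
      - A.mulVec w) ≤ l2norm e := by
  have hinj : Function.Injective (A.transpose * A).mulVec := by
    intro x y hxy
    have h1 : (A.conjTranspose * A).mulVec (x - y) = 0 := by
      rw [Matrix.conjTranspose_eq_transpose_of_trivial, Matrix.mulVec_sub, sub_eq_zero]; exact hxy
    rw [Matrix.conjTranspose_mul_self_mulVec_eq_zero, Matrix.mulVec_sub, sub_eq_zero] at h1
    exact hA h1
  have hunit : IsUnit (A.transpose * A).det :=
    (Matrix.isUnit_iff_isUnit_det _).1 (Matrix.mulVec_injective_iff_isUnit.1 hinj)
  set g := (A.transpose * A)⁻¹.mulVec (A.transpose.mulVec e) with hg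
  have h1 : A.mulVec ((A.transpose * A)⁻¹.mulVec (A.transpose.mulVec (A.mulVec w + e)))
      - A.mulVec w = A.mulVec g := by
    have h0 : (A.transpose * A)⁻¹.mulVec (A.transpose.mulVec (A.mulVec w)) = w := by
      rw [Matrix.mulVec_mulVec w, Matrix.mulVec_mulVec, Matrix.nonsing_inv_mul _ hunit,
        Matrix.one_mulVec]
    rw [Matrix.mulVec_add A.transpose, Matrix.mulVec_add _ (A.transpose.mulVec (A.mulVec w)), h0,
      Matrix.mulVec_add A, add_sub_cancel_left]
  have h2 : A.transpose.mulVec (A.mulVec g) = A.transpose.mulVec e := by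
    rw [hg, Matrix.mulVec_mulVec, Matrix.mulVec_mulVec, Matrix.mul_nonsing_inv _ hunit,
      Matrix.one_mulVec]
  -- By the normal equations `A g` is the orthogonal projection of `e`, so `‖A g‖² = ⟨A g, e⟩` and
  -- Cauchy–Schwarz concludes.
  have h3 : ∑ i, A.mulVec g i ^ 2 = ∑ i, A.mulVec g i * e i := by
    have h4 : ∀ y : m → ℝ, ∑ i, A.mulVec g i * y i = dotProduct g (A.transpose.mulVec y) := by
      intro y
      rw [Matrix.dotProduct_mulVec, Matrix.vecMul_transpose]
      rfl
    rw [h4 e, ← h2, ← h4]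
    exact Finset.sum_congr rfl fun i _ => sq _
  rw [h1]
  refine Real.sqrt_le_sqrt ?_
  have h5 := Finset.sum_mul_sq_le_sq_mul_sq Finset.univ (A.mulVec g) e
  rw [← h3] at h5
  rcases (Finset.sum_nonneg fun i _ => sq_nonneg (A.mulVec g i) :
    0 ≤ ∑ i, A.mulVec g i ^ 2).eq_or_lt with h0 | h0
  · rw [← h0]; exact Finset.sum_nonneg fun _ _ => sq_nonneg _
  · rw [sq] at h5; exact le_of_mul_le_mul_left h5 h0

/-- Columns of the design with block index in `L`. -/
def designColumns {n J N : ℕ} (L : Finset (Fin N)) (X : Design n J N) :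
    Matrix (Fin n) {p : Fin J × Fin N // p.2 ∈ L} ℝ :=
  Matrix.of fun i p => X i p

/-- The signal with entries `w` in the columns of `L` and `0` elsewhere. -/
def extendColumns {J N : ℕ} (L : Finset (Fin N)) (w : {p : Fin J × Fin N // p.2 ∈ L} → ℝ) :
    Signal J N :=
  fun p => if h : p.2 ∈ L then w ⟨p, h⟩ else 0

/-- The least squares estimate among the signals supported on the columns in `L`. -/
def leastSquares {n J N : ℕ} (L : Finset (Fin N)) (q : Design n J N × (Fin n → ℝ)) : Signal J N :=
  extendColumns L (((designColumns L q.1).transpose * designColumns L q.1)⁻¹.mulVec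
    ((designColumns L q.1).transpose.mulVec q.2))

theorem extendColumns_of_notMem {J N : ℕ} {L : Finset (Fin N)}
    (w : {p : Fin J × Fin N // p.2 ∈ L} → ℝ) {p : Fin J × Fin N} (hp : p.2 ∉ L) :
    extendColumns L w p = 0 := dif_neg hp

theorem extendColumns_restrict {J N : ℕ} {L : Finset (Fin N)} {β : Signal J N}
    (hβ : ∀ p : Fin J × Fin N, p.2 ∉ L → β p = 0) : extendColumns L (fun p => β p) = β := by
  ext p
  by_cases hp : p.2 ∈ L
  · simp [extendColumns, hp]
  · rw [extendColumns_of_notMem _ hp, hβ p hp]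

theorem designMul_extendColumns {n J N : ℕ} (L : Finset (Fin N)) (X : Design n J N)
    (w : {p : Fin J × Fin N // p.2 ∈ L} → ℝ) :
    designMul X (extendColumns L w) = (designColumns L X).mulVec w := by
  ext i
  have h1 : ∑ p, X i p * extendColumns L w p =
      ∑ p ∈ Finset.univ.filter fun p : Fin J × Fin N => p.2 ∈ L, X i p * extendColumns L w p := by
    refine (Finset.sum_subset (Finset.subset_univ _) fun p _ hp => ?_).symm
    rw [extendColumns_of_notMem w (by simpa using hp), mul_zero]
  rw [designMul, h1, Finset.sum_subtype (p := fun p : Fin J × Fin N => p.2 ∈ L) _ (by simp)]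
  simp only [Matrix.mulVec, dotProduct, designColumns, Matrix.of_apply]
  exact Finset.sum_congr rfl fun p _ => by rw [extendColumns, dif_pos p.2]

theorem measurable_leastSquares {n J N : ℕ} (L : Finset (Fin N)) :
    Measurable (leastSquares L : Design n J N × (Fin n → ℝ) → Signal J N) := by
  have hA : Continuous fun q : Design n J N × (Fin n → ℝ) => designColumns L q.1 :=
    continuous_matrix fun i p => by simp only [designColumns, Matrix.of_apply]; fun_prop
  have hG := hA.matrix_transpose.matrix_mul hA
  have hv : Continuous fun q : Design n J N × (Fin n → ℝ) =>
      (designColumns L q.1).transpose.mulVec q.2 := hA.matrix_transpose.matrix_mulVec continuous_snd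
  refine measurable_pi_lambda _ fun p => ?_
  by_cases hp : p.2 ∈ L
  · simp only [leastSquares, extendColumns, hp, dif_pos, Matrix.mulVec, dotProduct]
    refine Finset.measurable_sum _ fun j _ => Measurable.mul ?_ ?_
    -- Writing the inverse as adjugate over determinant, with value zero at a vanishing determinant,
    -- gives measurability on singular Gram matrices as well.
    · simp only [Matrix.inv_def, Matrix.smul_apply, smul_eq_mul, Ring.inverse_eq_inv']
      exact hG.matrix_det.measurable.inv.mul
        (hG.matrix_adjugate.matrix_elem ⟨p, hp⟩ j).measurable
    · exact ((continuous_apply j).comp hv).measurable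
  · simp only [leastSquares, extendColumns, hp, dif_neg, not_false_eq_true]
    exact measurable_const

/-- A new candidate replaces the current best on the measurable set where its residual is no larger;
carrying the minimum `ρ` along keeps that set measurable. -/
theorem exists_measurable_argmin {ι Ω S : Type*} [MeasurableSpace Ω] [MeasurableSpace S]
    {s : Finset ι} (hs : s.Nonempty) {b : ι → Ω → S} (hb : ∀ i, Measurable (b i))
    {r : ι → Ω → ℝ} (hr : ∀ i, Measurable (r i)) :
    ∃ (Δ : Ω → S) (ρ : Ω → ℝ), Measurable Δ ∧ Measurable ρ ∧
      ∀ ω, (∃ i ∈ s, Δ ω = b i ω ∧ ρ ω = r i ω) ∧ ∀ j ∈ s, ρ ω ≤ r j ω := by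
  classical
  induction hs using Finset.Nonempty.cons_induction with
  | singleton i =>
    exact ⟨b i, r i, hb i, hr i, fun ω => ⟨⟨i, by simp⟩, by simp⟩⟩
  | cons i s hi hs ih =>
    obtain ⟨Δ, ρ, hΔ, hρ, h⟩ := ih
    have hm : MeasurableSet {ω | r i ω ≤ ρ ω} := measurableSet_le (hr i) hρ
    refine ⟨fun ω => if r i ω ≤ ρ ω then b i ω else Δ ω,
      fun ω => if r i ω ≤ ρ ω then r i ω else ρ ω, (hb i).ite hm hΔ, (hr i).ite hm hρ,
      fun ω => ?_⟩
    obtain ⟨⟨k, hk, hk'⟩, hmin⟩ := h ω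
    by_cases hω : r i ω ≤ ρ ω
    · simp only [hω, if_true]
      refine ⟨⟨i, by simp⟩, fun j hj => ?_⟩
      rcases Finset.mem_cons.1 hj with rfl | hj
      · exact le_rfl
      · exact hω.trans (hmin j hj)
    · simp only [hω, if_false]
      refine ⟨⟨k, Finset.mem_cons.2 (Or.inr hk), hk'⟩, fun j hj => ?_⟩
      rcases Finset.mem_cons.1 hj with rfl | hj
      · exact (not_le.1 hω).le
      · exact hmin j hj

theorem measurable_residual {n J N : ℕ} (L : Finset (Fin N)) :
    Measurable fun q : Design n J N × (Fin n → ℝ) =>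
      l2norm (designMul q.1 (leastSquares L q) - q.2) := by
  have h : ∀ p, Measurable fun q : Design n J N × (Fin n → ℝ) => leastSquares L q p :=
    fun p => (measurable_pi_apply p).comp (measurable_leastSquares L)
  unfold l2norm designMul
  simp only [Pi.sub_apply]
  fun_prop

/-- On designs that are bounded below on `2 K`-block-sparse signals, least squares over the best
support recovers `K`-block-sparse signals stably. -/
theorem exists_measurable_decoder (n J : ℕ) {N K : ℕ} (hKN : K ≤ N) :
    ∃ Δ : Design n J N × (Fin n → ℝ) → Signal J N, Measurable Δ ∧ ∀ X : Design n J N,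
      (∀ (L : Finset (Fin N)) (h : Signal J N), L.card ≤ 2 * K →
        (∀ p : Fin J × Fin N, p.2 ∉ L → h p = 0) → l2norm h ≤ 20 * l2norm (designMul X h)) →
      ∀ β ∈ blockSparse J N K, ∀ e : Fin n → ℝ,
        l2norm (β - Δ (X, designMul X β + e)) ≤ 60 * l2norm e := by
  have hne : (Finset.powersetCard K (Finset.univ : Finset (Fin N))).Nonempty :=
    Finset.powersetCard_nonempty.2 (by simpa using hKN)
  obtain ⟨Δ, ρ, hΔ, -, hmin⟩ := exists_measurable_argmin hne
    (fun L => measurable_leastSquares (n := n) (J := J) L) (fun L => measurable_residual L)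
  refine ⟨Δ, hΔ, fun X hX β ⟨L, hL, hβ⟩ e => ?_⟩
  have hβ' : ∀ p : Fin J × Fin N, p.2 ∉ L → β p = 0 := fun p hp => hβ p.1 p.2 hp
  set z := designMul X β + e with hz
  obtain ⟨⟨L', hL', hΔL', hρL'⟩, hle⟩ := hmin (X, z)
  have hL'c := (Finset.mem_powersetCard.1 hL').2
  have hres := hle L (Finset.mem_powersetCard.2 ⟨Finset.subset_univ _, hL⟩)
  rw [hρL', ← hΔL'] at hres
  -- The lower bound on `X` makes the columns over the true support independent, so least squares
  -- there projects the noise. No such property is needed for the selected support `L'`.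
  have hinj : Function.Injective (designColumns L X).mulVec := by
    intro w w' hww
    have h1 : l2norm (extendColumns L (w - w')) = 0 := by
      refine le_antisymm ((hX L _ (by omega) fun p hp => extendColumns_of_notMem _ hp).trans ?_)
        (l2norm_nonneg _)
      rw [designMul_extendColumns, Matrix.mulVec_sub, sub_eq_zero.2 hww]
      simp [l2norm]
    ext p
    have h2 := congrFun (l2norm_eq_zero h1) p.1
    rw [extendColumns, dif_pos p.2] at h2
    exact sub_eq_zero.1 h2
  have hβA : designMul X β = (designColumns L X).mulVec fun p => β p := by
    rw [← designMul_extendColumns, extendColumns_restrict hβ']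
  have hls : l2norm (designMul X (leastSquares L (X, z)) - designMul X β) ≤ l2norm e := by
    rw [leastSquares, designMul_extendColumns, hz, hβA]
    exact l2norm_leastSquares_sub_le _ hinj _ _
  have h1 : l2norm (designMul X (leastSquares L (X, z)) - z) ≤ 2 * l2norm e := by
    have h2 : designMul X (leastSquares L (X, z)) - z =
        (designMul X (leastSquares L (X, z)) - designMul X β) + -e := by rw [hz]; abel
    rw [h2]
    refine (l2norm_add_le _ _).trans ?_
    rw [l2norm_neg]; linarith
  -- The selected support has residual no larger than the true one, hence at most `2 ‖e‖`; removing
  -- the noise costs one more `‖e‖`. With the factor 20 on the at most `2 K` columns of `L ∪ L'`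
  -- this gives 60.
  have h3 : l2norm (designMul X (β - Δ (X, z))) ≤ 3 * l2norm e := by
    have h4 : designMul X (β - Δ (X, z)) = -(designMul X (Δ (X, z)) - z) + -e := by
      rw [designMul_sub, hz]; abel
    rw [h4]
    refine (l2norm_add_le _ _).trans ?_
    rw [l2norm_neg, l2norm_neg]
    linarith [hres.trans h1]
  have h5 := hX (L ∪ L') (β - Δ (X, z))
    ((Finset.card_union_le _ _).trans (by omega)) fun p hp => by
      rw [Finset.mem_union, not_or] at hp
      rw [Pi.sub_apply, hβ' p hp.1, hΔL', leastSquares, extendColumns_of_notMem _ hp.2, sub_zero]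
  linarith

end

/-! ### Assembly of the five statements. -/

theorem mainTheorem4 :
    -- the cardinality of the model
    (∀ (J N K : ℕ) (u v : ℝ), 1 ≤ J → 1 ≤ K → K ≤ N → u ≠ 0 → v ≠ 0 → u ≠ v →
      (blockEnsemble J N K u v).Finite ∧
      (blockEnsemble J N K u v).ncard = 2 ^ (K * J) * N.choose K ∧
      (2 : ℝ) ^ (K * J) * ((N : ℝ) / K) ^ K ≤ ((blockEnsemble J N K u v).ncard : ℝ)) ∧
    -- necessary number of samples, noisy case, procedures that see the observations
    (∃ c : ℝ, 0 < c ∧ ∃ ε : ℝ, 0 < ε ∧ ε < 1 ∧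
      ∀ (J N K n : ℕ) (σ : ℝ≥0) (C₀ u v : ℝ), 1 ≤ J → 1 ≤ K → K ≤ N → 0 < σ → 0 < C₀ →
        u = C₀ * σ * Real.sqrt (J * N) / Real.sqrt (2 * (1 - ε)) →
        v = u + C₀ * σ * Real.sqrt (J * N) / Real.sqrt (1 - ε) →
        (n : ℝ) ≤ c * blockSampleOrder J N K →
        ∀ f : (Fin n → ℝ) → (Fin n → ℝ), Measurable f →
        ∀ κ : Kernel (Fin n → ℝ) (Signal J N), IsMarkovKernel κ →
        ∀ C : ℝ, 0 < C → C ≤ C₀ →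
          1 / 10 ≤ noisyError (blockEnsemble J N K u v) (gaussianDesign n J N 0 1)
            (gaussianNoise n σ) f κ C) ∧
    -- necessary number of samples, noiseless case, procedures that see the observations
    (∃ c : ℝ, 0 < c ∧
      ∀ (J N K n : ℕ), 1 ≤ J → 1 ≤ K → K ≤ N →
        (n : ℝ) ≤ c * blockSampleOrder J N K →
        ∀ f : (Fin n → ℝ) → (Fin n → ℝ), Measurable f →
        ∀ κ : Kernel (Fin n → ℝ) (Signal J N), IsMarkovKernel κ →
          1 / 2 ≤ noiselessError (blockEnsemble J N K 1 (-1))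
            (gaussianDesign n J N (1 / ((K * J : ℝ) * Real.sqrt 2)) (1 / (K * J : ℝ≥0))) f κ) ∧
    -- necessary number of samples, noisy case, procedures that also see the design matrix
    (∀ C₀ : ℝ, 0 < C₀ → ∃ c : ℝ, 0 < c ∧
      ∀ (J N K : ℕ) (σ : ℝ≥0), 1 ≤ J → 1 ≤ K → K ≤ N → 0 < σ →
        ∃ u v : ℝ, u ≠ 0 ∧ v ≠ 0 ∧ u ≠ v ∧
          ∀ n : ℕ, (n : ℝ) ≤ c * blockSampleOrder J N K →
          ∀ f : (Fin n → ℝ) → (Fin n → ℝ), Measurable f →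
          ∀ κ : Kernel (Design n J N × (Fin n → ℝ)) (Signal J N), IsMarkovKernel κ →
          ∀ C : ℝ, 0 < C → C ≤ C₀ →
            1 / 10 ≤ noisyErrorKnownDesign (blockEnsemble J N K u v)
              (gaussianDesign n J N 0 (1 / (n : ℝ≥0))) (gaussianNoise n σ) f κ C) ∧
    -- the matching upper bound: this order of samples suffices for stable recovery
    (∃ C₁ C₂ : ℝ, 0 < C₁ ∧ 0 < C₂ ∧
      ∀ (J N K n : ℕ), 1 ≤ J → 1 ≤ K → K ≤ N →
        C₁ * blockSampleOrder J N K ≤ (n : ℝ) →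
        ∃ Δ : Design n J N × (Fin n → ℝ) → Signal J N, Measurable Δ ∧
          gaussianDesign n J N 0 (1 / (n : ℝ≥0))
              {X | ¬ ∀ β ∈ blockSparse J N K, ∀ e : Fin n → ℝ,
                l2norm (β - Δ (X, designMul X β + e)) ≤ C₂ * l2norm e}
            ≤ ENNReal.ofReal (Real.exp (-(n : ℝ) / C₁))) := by
  refine ⟨?_, ?_, ?_, ?_, ?_⟩
  · intro J N K u v hJ hK hKN hu hv huv
    rw [← coe_blockEnsembleFinset, Set.ncard_coe_finset,
      card_blockEnsembleFinset N K hJ hu hv huv]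
    refine ⟨Finset.finite_toSet _, rfl, ?_⟩
    push_cast
    exact mul_le_mul_of_nonneg_left (div_pow_le_choose N K hKN) (by positivity)
  -- With `ε = 1 / 2` the value `u` is exactly `C₀ σ √d`, and `v - u = √2 u ≥ u`, as the separation
  -- requires.
  · refine ⟨1 / 100, by norm_num, 1 / 2, by norm_num, by norm_num, ?_⟩
    intro J N K n σ C₀ u v hJ hK hKN hσ hC₀ hu hv hn f hf κ hκ C hC hCC₀
    have hu' : u = C₀ * σ * Real.sqrt (J * N) := by
      rw [hu, show (2 * (1 - 1 / 2) : ℝ) = 1 by norm_num, Real.sqrt_one, div_one]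
    refine noisy_necessary_samples hJ hK hKN hσ hC₀ hu' ?_ hn hf κ hC hCC₀
    have h1 : Real.sqrt (1 - 1 / 2) ≤ 1 := Real.sqrt_le_one.2 (by norm_num)
    have h2 : 0 < Real.sqrt (1 - 1 / 2) := Real.sqrt_pos.2 (by norm_num)
    rw [hv, ← hu', two_mul]
    refine add_le_add_right ((le_div_iff₀ h2).2 (mul_le_of_le_one_right ?_ h1)) u
    rw [hu']; positivity
  · refine ⟨1 / 100, by norm_num, ?_⟩
    intro J N K n hJ hK hKN hn f hf κ hκ
    exact noiseless_necessary_samples hJ hK hKN hn hf κ (by norm_num) (by norm_num) (by norm_num)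
      _ _
  · intro C₀ hC₀
    refine ⟨1 / (140 * (400 * C₀ ^ 2 + 40)), by positivity, ?_⟩
    intro J N K σ hJ hK hKN hσ
    set c := 1 / (140 * (400 * C₀ ^ 2 + 40)) with hc
    have hc0 : 0 < c := by positivity
    have hm : 0 < blockSampleOrder J N K := one_pos.trans_le (one_le_blockSampleOrder hJ hK hKN)
    have hs : (0 : ℝ) < (K * J : ℕ) := by exact_mod_cast Nat.mul_pos hK hJ
    have hσ' : (0 : ℝ) < σ := hσ
    -- The prescribed squared norm `K J u²` of all signals in the ensemble with values `±u`. It does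
    -- not involve `n`, so one pair of values works for every admissible `n`.
    set y := 800 * C₀ ^ 2 * c * blockSampleOrder J N K * σ ^ 2 with hy
    have hy0 : 0 < y := by positivity
    have hu : 0 < Real.sqrt (y / (K * J : ℕ)) := Real.sqrt_pos.2 (by positivity)
    refine ⟨Real.sqrt (y / (K * J : ℕ)), -Real.sqrt (y / (K * J : ℕ)), hu.ne', by linarith,
      by linarith, ?_⟩
    intro n hn f hf κ hκ C hC hCC₀
    refine noisyKnownDesign_necessary_samples hJ hK hKN hσ hc hu ?_ hn hf κ hC hCC₀
    rw [Real.sq_sqrt (by positivity)]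
    exact mul_div_cancel₀ y hs.ne'
  · refine ⟨160012, 60, by norm_num, by norm_num, ?_⟩
    intro J N K n hJ hK hKN hn
    obtain ⟨Δ, hΔ, h⟩ := exists_measurable_decoder n J hKN
    refine ⟨Δ, hΔ, le_trans (measure_mono ?_) (gaussianDesign_not_bounded_below_le hJ hK hKN hn)⟩
    exact fun X hX hgood => hX (h X hgood)
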